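/- Let $n\ge 0$, let $d=(d_1,\dots,d_n)$ be a vector of positive integers and let $\Delta$ be a simplicial complex on $[n]=\{1,\dots,n\}$, i.e. a family of subsets of $[n]$ that contains $\emptyset$ and is closed under taking subsets. Let $A_\Delta$ be the $0/1$ matrix that computes the margins of a $d_1\times\cdots\times d_n$ table $\mathbf x$ along the facets (inclusion-maximal faces) $S$ of $\Delta$: its columns are indexed by the cells $c\in\prod_{i=1}^n\{0,\dots,d_i-1\}$, its rows by the pairs $(S,j)$ with $S$ a facet of $\Delta$ and $j\in\prod_{i\in S}\{0,\dots,d_i-1\}$, and the entry in row $(S,j)$ and column $c$ is $1$ if $c|_S=j$ and $0$ otherwise. Let $P_\Delta$ be the convex hull of the columns of $A_\Delta$. For an integral vector $b$ let $$IP^+_{\mathbf 0}(A_\Delta,b)=\max\{x_{\mathbf 0} : A_\Delta\mathbf x=b,\ \mathbf x\ge 0,\ \mathbf x \text{ integral}\},\qquad LP^+_{\mathbf 0}(A_\Delta,b)=\max\{x_{\mathbf 0} : A_\Delta\mathbf x=b,\ \mathbf x\ge 0,\ \mathbf x \text{ real}\},$$ where $\mathbf 0$ is the cell $(0,\dots,0)$.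 Then $IP^+_{\mathbf 0}(A_\Delta,b)=LP^+_{\mathbf 0}(A_\Delta,b)$ for all marginals $b$ (that is, all $b=A_\Delta\mathbf x$ with $\mathbf x$ nonnegative and integral) if and only if $P_\Delta$ is compressed. Here the lattice points of $P_\Delta$ are its points in the smallest lattice (additive subgroup) containing the columns of $A_\Delta$. The pulling triangulation of a lattice polytope $P$ induced by an ordering $p_1,\dots,p_k$ of its lattice points is defined recursively: it is $\{\{p_1,\dots,p_k\}\}$ if $p_1,\dots,p_k$ are affinely independent, and otherwise it consists of all $\{p_1\}\cup\sigma$, where $\sigma$ belongs to the pulling triangulation of a facet $F$ of $P$ with $p_1\notin F$, taken with the induced ordering of the lattice points of $F$. The polytope $P$ is compressed if, for every ordering of its lattice points, every simplex of the pulling triangulation has the minimal volume among all full-dimensional simplices that are convex hulls of lattice points of $P$. -/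

import Mathlib

open MeasureTheory

noncomputable section

section Polytopes

variable {E : Type*} [NormedAddCommGroup E] [InnerProductSpace ℝ E]

/-- The dimension of the affine hull of a set. -/
def affDim (P : Set E) : ℕ :=
  Module.finrank ℝ (vectorSpan ℝ P)

/-- `F` is a facet of the polytope `P`: a nonempty face, that is, the set of maximizers of a linear
functional on `P`, of dimension one less than that of `P`. -/
def IsFacetOf (F P : Set E) : Prop :=
  F.Nonempty ∧ IsExposed ℝ P F ∧ affDim F + 1 = affDim P

open Classical in
/-- `IsPullingSimplex P l σ`: the set `σ` is (the vertex set of) one of the simplices of the pulling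
triangulation of the polytope `P` induced by the ordered list `l` of its lattice points. -/
inductive IsPullingSimplex : Set E → List E → Set E → Prop
  | base (P : Set E) (l : List E)
      (hl : AffineIndependent ℝ (fun x : {x // x ∈ l} => (x : E))) :
      IsPullingSimplex P l {x | x ∈ l}
  | pull (P : Set E) (p : E) (l : List E) (F : Set E) (σ : Set E)
      (hl : ¬ AffineIndependent ℝ (fun x : {x // x ∈ p :: l} => (x : E)))
      (hF : IsFacetOf F P) (hp : p ∉ F)
      (hσ : IsPullingSimplex F ((p :: l).filter (fun x => x ∈ F)) σ) :
      IsPullingSimplex P (p :: l) (insert p σ)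

/-- The points of the lattice `L` in the polytope `P`. -/
def latticePoints (P : Set E) (L : AddSubgroup E) : Set E :=
  {x | x ∈ P ∧ x ∈ L}

/-- The `dim P`-dimensional Euclidean volume of the convex hull of `σ`. -/
def simplexVolume [MeasurableSpace E] [BorelSpace E] (P σ : Set E) : ENNReal :=
  Measure.euclideanHausdorffMeasure (affDim P) (convexHull ℝ σ)

/-- The convex hull of `σ` has minimal volume among all (full-dimensional) simplices that are convex
hulls of lattice points in `P`. -/
def HasMinimalVolume [MeasurableSpace E] [BorelSpace E]
    (P : Set E) (L : AddSubgroup E) (σ : Set E) : Prop :=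
  ∀ τ : Set E, τ.Nonempty → τ ⊆ latticePoints P L → AffineIndependent ℝ (fun x : τ => (x : E)) →
    affDim τ = affDim P → simplexVolume P σ ≤ simplexVolume P τ

/-- The lattice polytope `P` is compressed with respect to the lattice `L`: for each ordering of the
lattice points in `P`, all simplices of the pulling triangulation have minimal volume. -/
def IsCompressed [MeasurableSpace E] [BorelSpace E] (P : Set E) (L : AddSubgroup E) : Prop :=
  ∀ l : List E, l.Nodup → (∀ x, x ∈ l ↔ x ∈ latticePoints P L) →
    ∀ σ : Set E, IsPullingSimplex P l σ → HasMinimalVolume P L σ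

end Polytopes

section Matrices

variable {ρ κ : Type*} [Fintype ρ] [Fintype κ]

/-- The set of columns of an integral matrix, as points of Euclidean space. -/
def columnSet (A : Matrix ρ κ ℤ) : Set (EuclideanSpace ℝ ρ) :=
  Set.range fun j => WithLp.toLp 2 fun r => (A r j : ℝ)

/-- The polytope `P_A`, the convex hull of the columns of `A`. -/
def columnPolytope (A : Matrix ρ κ ℤ) : Set (EuclideanSpace ℝ ρ) :=
  convexHull ℝ (columnSet A)

/-- The smallest lattice containing the columns of `A`. -/
def columnLattice (A : Matrix ρ κ ℤ) : AddSubgroup (EuclideanSpace ℝ ρ) :=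
  AddSubgroup.closure (columnSet A)

/-- `b = A x` for some nonnegative integral `x`. -/
def IPFeasible (A : Matrix ρ κ ℤ) (b : ρ → ℤ) : Prop :=
  ∃ x : κ → ℤ, 0 ≤ x ∧ A.mulVec x = b

/-- The optimal value of: maximize `x i` subject to `A x = b`, `x ≥ 0`, `x` integral. -/
def IPMax (A : Matrix ρ κ ℤ) (b : ρ → ℤ) (i : κ) : EReal :=
  sSup {v | ∃ x : κ → ℤ, 0 ≤ x ∧ A.mulVec x = b ∧ v = ((x i : ℝ) : EReal)}

/-- The optimal value of: maximize `x i` subject to `A x = b`, `x ≥ 0`, `x` real. -/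
def LPMax (A : Matrix ρ κ ℤ) (b : ρ → ℤ) (i : κ) : EReal :=
  sSup {v | ∃ x : κ → ℝ, 0 ≤ x ∧
    (A.map (Int.cast : ℤ → ℝ)).mulVec x = (fun r => (b r : ℝ)) ∧ v = (x i : EReal)}

end Matrices

section Marginals

/-- A simplicial complex on `[n]`: a family of subsets that contains the empty set and is closed
under taking subsets. (Not every element of `[n]` has to be a vertex.) -/
structure MarginComplex (n : ℕ) where
  faces : Set (Finset (Fin n))
  empty_mem : ∅ ∈ faces
  down_closed : ∀ S ∈ faces, ∀ T ⊆ S, T ∈ faces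

variable {n : ℕ}

/-- The facets (inclusion-maximal faces) of `Δ`. -/
def MarginComplex.Facet (Δ : MarginComplex n) : Type :=
  {S : Finset (Fin n) // Maximal (fun T => T ∈ Δ.faces) S}

/-- The cells of a `d₁ × ⋯ × dₙ` table. -/
abbrev Cell (d : Fin n → ℕ) : Type :=
  ∀ i, Fin (d i)

/-- The entries of all the released margins: pairs of a facet `S` of `Δ` and a cell of the
`S`-margin. -/
def MarginIndex (Δ : MarginComplex n) (d : Fin n → ℕ) : Type :=
  Σ S : Δ.Facet, ∀ i : {i // i ∈ S.1}, Fin (d i)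

instance (Δ : MarginComplex n) : Finite Δ.Facet :=
  inferInstanceAs (Finite {S : Finset (Fin n) // Maximal (fun T => T ∈ Δ.faces) S})

instance (Δ : MarginComplex n) (d : Fin n → ℕ) : Finite (MarginIndex Δ d) :=
  inferInstanceAs (Finite (Σ S : Δ.Facet, ∀ i : {i // i ∈ S.1}, Fin (d i)))

instance (Δ : MarginComplex n) (d : Fin n → ℕ) : Fintype (MarginIndex Δ d) :=
  Fintype.ofFinite _

/-- The matrix `A_Δ` computing the `Δ`-margins of a table: the entry `(S, j)` of the margin is the
sum of the cells `c` whose restriction to `S` is `j`. -/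
def marginalMatrix (Δ : MarginComplex n) (d : Fin n → ℕ) :
    Matrix (MarginIndex Δ d) (Cell d) ℤ :=
  fun r c => if (fun i : {i // i ∈ r.1.1} => c i) = r.2 then 1 else 0

end Marginals

end

/-! The total of one margin is a linear functional `s` equal to 1 on every column, so affine
questions about the polytope become linear questions about its cone, and facets become functionals
`h ≥ 0` on the columns. As the matrix is `0/1`, the lattice points of the polytope are exactly the
columns. Cyclic shifts of the table act transitively on cells, so the optimization condition at the
cell `0` is equivalent to `HasIntegralMaximum` at every cell.

Integral maxima imply compressed: by induction along faces, the vertices of each pulling simplex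
generate all columns of the face over the integers. Let `v i` be the apex over a facet `h = 0`, and
write another column `v j` of the face as `α • v i` plus a real combination of facet vertices. After
adding a large multiple of the facet vertices this is a feasible real point; an integral point with
coefficient at least `α` at `i` exists, and comparing values of `h` forces its remaining support
into the facet (`mem_closure_insert_of_hasIntegralMaximum`). A generating simplex has minimal
volume, because any other one is its image under a map of nonzero integral determinant.

Compressed implies integral maxima: for two vertices `p`, `q` off a facet, pulling `p` or `q` first
yields pyramids over the same simplex, with volume ratio `h q / h p`; both are minimal, so `h p = h
q` (`IsCompressed.map_eq_map_of_facet`). Thus `h` takes values in integer multiples of `h (v i)` on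
the lattice whenever `h (v i) > 0`. For a lattice point `b` with real coefficient `y i`, the bound
`h b ≥ y i * h (v i)` therefore rounds up to `⌈y i⌉`, and `b - ⌈y i⌉ • v i` stays in the cone.
Iterating produces an integral representation. -/

noncomputable section

/-! ### Faces and facets of a polytope through linear functionals on its cone -/

section Convex

variable {E : Type*} [NormedAddCommGroup E] [InnerProductSpace ℝ E]

/-- A face of a polytope is the convex hull of the vertices it contains. -/
theorem sep_convexHull_eq_zero {V : Set E} {h : E →ₗ[ℝ] ℝ} (h0 : ∀ v ∈ V, 0 ≤ h v) :
    {x ∈ convexHull ℝ V | h x = 0} = convexHull ℝ {v ∈ V | h v = 0} := by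
  have hN : ∀ x ∈ convexHull ℝ {v ∈ V | 0 < h v}, 0 < h x := by
    intro x hx
    have : convexHull ℝ {v ∈ V | 0 < h v} ⊆ {x | 0 < h x} :=
      convexHull_min (fun v hv => hv.2) (convex_halfSpace_gt h.isLinear 0)
    exact this hx
  have hZ : ∀ x ∈ convexHull ℝ {v ∈ V | h v = 0}, h x = 0 := by
    intro x hx
    have : convexHull ℝ {v ∈ V | h v = 0} ⊆ {x | h x = 0} :=
      convexHull_min (fun v hv => hv.2) (convex_hyperplane h.isLinear 0)
    exact this hx
  apply Set.Subset.antisymm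
  · rintro x ⟨hx, hx0⟩
    have hV : V = {v ∈ V | h v = 0} ∪ {v ∈ V | 0 < h v} := by
      ext v
      constructor
      · intro hv
        rcases (h0 v hv).eq_or_lt with h1 | h1
        · exact Or.inl ⟨hv, h1.symm⟩
        · exact Or.inr ⟨hv, h1⟩
      · rintro (hv | hv) <;> exact hv.1
    rcases Set.eq_empty_or_nonempty {v ∈ V | h v = 0} with hZe | hZn
    · rw [hV, hZe, Set.empty_union] at hx
      exact absurd hx0 (hN x hx).ne'
    rcases Set.eq_empty_or_nonempty {v ∈ V | 0 < h v} with hNe | hNn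
    · rwa [hV, hNe, Set.union_empty] at hx
    rw [hV, convexHull_union hZn hNn, mem_convexJoin] at hx
    obtain ⟨z, hz, y, hy, a, b, ha, hb, hab, rfl⟩ := hx
    simp only [map_add, map_smul, smul_eq_mul, hZ z hz, mul_zero, zero_add, mul_eq_zero,
      (hN y hy).ne', or_false] at hx0
    subst hx0
    obtain rfl : a = 1 := by linarith
    simpa using hz
  · exact fun x hx => ⟨convexHull_mono (fun v hv => hv.1) hx, hZ x hx⟩

theorem map_eq_one_of_mem_convexHull {V : Set E} {s : E →ₗ[ℝ] ℝ} (hs : ∀ v ∈ V, s v = 1) {x : E}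
    (hx : x ∈ convexHull ℝ V) : s x = 1 := by
  have : convexHull ℝ V ⊆ {x | s x = 1} := convexHull_min hs (convex_hyperplane s.isLinear 1)
  exact this hx

theorem map_eq_zero_of_mem_vectorSpan {V : Set E} {s : E →ₗ[ℝ] ℝ} (hs : ∀ v ∈ V, s v = 1) {x : E}
    (hx : x ∈ vectorSpan ℝ V) : s x = 0 := by
  have : vectorSpan ℝ V ≤ LinearMap.ker s := by
    refine Submodule.span_le.2 ?_
    rintro _ ⟨a, ha, b, hb, rfl⟩
    simp [hs a ha, hs b hb]
  exact this hx

theorem vectorSpan_convexHull_eq (V : Set E) : vectorSpan ℝ (convexHull ℝ V) = vectorSpan ℝ V := by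
  rw [← direction_affineSpan, affineSpan_convexHull, direction_affineSpan]

theorem affDim_convexHull (V : Set E) : affDim (convexHull ℝ V) = affDim V := by
  rw [affDim, vectorSpan_convexHull_eq, affDim]

/-- The hyperplane `s = 1` misses the origin, so a single point of `V` spans a complement of the
direction space. -/
theorem finrank_span_eq_affDim_add_one [FiniteDimensional ℝ E] {V : Set E} (hV : V.Nonempty)
    {s : E →ₗ[ℝ] ℝ} (hs : ∀ v ∈ V, s v = 1) :
    Module.finrank ℝ (Submodule.span ℝ V) = affDim V + 1 := by
  obtain ⟨p, hp⟩ := hV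
  have hp0 : p ≠ 0 := by
    rintro rfl
    simpa using hs 0 hp
  have hsup : Submodule.span ℝ V = vectorSpan ℝ V ⊔ Submodule.span ℝ {p} := by
    apply le_antisymm
    · refine Submodule.span_le.2 fun v hv => ?_
      have : v = (v - p) + p := by abel
      rw [this]
      exact Submodule.add_mem_sup (vsub_mem_vectorSpan ℝ hv hp) (Submodule.mem_span_singleton_self p)
    · refine sup_le (Submodule.span_le.2 ?_) (Submodule.span_mono (by simpa using hp))
      rintro _ ⟨a, ha, b, hb, rfl⟩
      exact Submodule.sub_mem _ (Submodule.subset_span ha) (Submodule.subset_span hb)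
  have hinf : vectorSpan ℝ V ⊓ Submodule.span ℝ {p} = ⊥ := by
    rw [eq_bot_iff]
    rintro x ⟨hx, hx'⟩
    obtain ⟨c, rfl⟩ := Submodule.mem_span_singleton.1 hx'
    have := map_eq_zero_of_mem_vectorSpan hs hx
    simp only [map_smul, hs p hp, smul_eq_mul, mul_one] at this
    simp [this]
  have := Submodule.finrank_sup_add_finrank_inf_eq (vectorSpan ℝ V) (Submodule.span ℝ {p})
  rw [← hsup, hinf, finrank_bot, finrank_span_singleton hp0] at this
  simpa [affDim] using this

/-- Applying `s` to a linear relation shows that its coefficients already sum to zero. -/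
theorem affineIndependent_iff_linearIndependent_of_map_eq_one {ι : Type*} {f : ι → E}
    {s : E →ₗ[ℝ] ℝ} (hs : ∀ i, s (f i) = 1) : AffineIndependent ℝ f ↔ LinearIndependent ℝ f := by
  rw [affineIndependent_iff, linearIndependent_iff']
  refine ⟨fun H t w hw => H t w ?_ hw, fun H t w _ hw => H t w hw⟩
  simpa [hs] using congrArg s hw

/-- A linear functional positive on a polytope and negative on a point outside of its cone. -/
theorem exists_pos_on_neg_at [FiniteDimensional ℝ E] {V : Set E} (hV : V.Finite)
    (hne : V.Nonempty) {s : E →ₗ[ℝ] ℝ} (hs : ∀ v ∈ V, s v = 1) {b : E}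
    (hb : ∀ c : ℝ, 0 ≤ c → ∀ k ∈ convexHull ℝ V, b ≠ c • k) :
    ∃ h : E →ₗ[ℝ] ℝ, (∀ v ∈ V, 0 ≤ h v) ∧ h b < 0 := by
  -- A functional separating this hull from the origin is positive on `V` and on `-b` at once.
  have h0 : (0 : E) ∉ convexHull ℝ (insert (-b) V) := by
    rw [convexHull_insert hne, mem_convexJoin]
    rintro ⟨x, hx, k, hk, t, u, ht, hu, htu, h⟩
    rw [Set.mem_singleton_iff] at hx
    subst hx
    rcases ht.eq_or_lt with rfl | ht
    · obtain rfl : u = 1 := by linarith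
      have := map_eq_one_of_mem_convexHull hs hk
      simp only [zero_smul, one_smul, zero_add] at h
      simp [h] at this
    · refine hb (t⁻¹ * u) (by positivity) k hk ?_
      rw [smul_neg, neg_add_eq_zero] at h
      rw [mul_smul, ← h, smul_smul, inv_mul_cancel₀ ht.ne', one_smul]
  obtain ⟨f, u, hf0, hf⟩ := geometric_hahn_banach_point_closed (convex_convexHull ℝ (insert (-b) V))
    ((hV.insert (-b)).isClosed_convexHull (𝕜 := ℝ)) h0
  rw [map_zero] at hf0
  refine ⟨f.toLinearMap, fun v hv => ?_, ?_⟩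
  · exact (hf0.trans (hf v (subset_convexHull ℝ _ (Set.mem_insert_of_mem _ hv)))).le
  · have := hf0.trans (hf (-b) (subset_convexHull ℝ _ (Set.mem_insert _ _)))
    simpa using this

/-- Tilting a nonnegative functional about its zero set, until it vanishes at a further point. -/
theorem exists_tilt {V : Set E} (hV : V.Finite) {h g : E →ₗ[ℝ] ℝ} (h0 : ∀ v ∈ V, 0 ≤ h v)
    {w : E} (hw : w ∈ V) (hgw : g w < 0) :
    ∃ t : ℝ, (∀ v ∈ V, 0 ≤ (h + t • g) v) ∧ ∃ v ∈ V, g v ≠ 0 ∧ (h + t • g) v = 0 := by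
  -- Ratio test: the smallest `h v / (-g v)` is the first `t` at which the tilted functional
  -- vanishes at a point where `g` is negative.
  obtain ⟨m, ⟨hm, hgm⟩, hmin⟩ := Set.exists_min_image {v ∈ V | g v < 0} (fun v => h v / (-g v))
    (hV.subset fun v hv => hv.1) ⟨w, hw, hgw⟩
  have ht : 0 ≤ h m / (-g m) := div_nonneg (h0 m hm) (by linarith)
  refine ⟨h m / (-g m), fun v hv => ?_, m, hm, hgm.ne, ?_⟩
  · simp only [LinearMap.add_apply, LinearMap.smul_apply, smul_eq_mul]
    rcases lt_or_ge (g v) 0 with hgv | hgv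
    · have := hmin v ⟨hv, hgv⟩
      rw [le_div_iff₀ (by linarith)] at this
      linarith
    · have := mul_nonneg ht hgv
      linarith [h0 v hv]
  · simp only [LinearMap.add_apply, LinearMap.smul_apply, smul_eq_mul]
    have : g m ≠ 0 := hgm.ne
    field_simp
    ring

/-- A point outside of the cone over a polytope is cut off by a facet. -/
theorem exists_facet_functional [FiniteDimensional ℝ E] {V : Set E} (hV : V.Finite)
    (hne : V.Nonempty) {s : E →ₗ[ℝ] ℝ} (hs : ∀ v ∈ V, s v = 1) {b : E}
    (hbV : b ∈ Submodule.span ℝ V)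
    (hb : ∀ c : ℝ, 0 ≤ c → ∀ k ∈ convexHull ℝ V, b ≠ c • k) :
    ∃ h : E →ₗ[ℝ] ℝ, (∀ v ∈ V, 0 ≤ h v) ∧ h b < 0 ∧
      Module.finrank ℝ (Submodule.span ℝ {v ∈ V | h v = 0}) + 1 =
        Module.finrank ℝ (Submodule.span ℝ V) := by
  let r : (E →ₗ[ℝ] ℝ) → ℕ := fun h => Module.finrank ℝ (Submodule.span ℝ {v ∈ V | h v = 0})
  have hlt : ∀ h : E →ₗ[ℝ] ℝ, h b < 0 → r h < Module.finrank ℝ (Submodule.span ℝ V) := by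
    intro h hhb
    refine Submodule.finrank_lt_finrank_of_lt (lt_of_le_of_ne (Submodule.span_mono fun v hv => hv.1) ?_)
    intro heq
    rw [← heq] at hbV
    have : Submodule.span ℝ {v ∈ V | h v = 0} ≤ LinearMap.ker h :=
      Submodule.span_le.2 fun v hv => hv.2
    exact hhb.ne (this hbV)
  -- Among all functionals cutting off `b`, one whose zero set has least corank is chosen; tilting
  -- will show that this corank is one.
  have hex : ∃ k, ∃ h : E →ₗ[ℝ] ℝ, ((∀ v ∈ V, 0 ≤ h v) ∧ h b < 0) ∧
      Module.finrank ℝ (Submodule.span ℝ V) - r h = k := by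
    obtain ⟨h, hh⟩ := exists_pos_on_neg_at hV hne hs hb
    exact ⟨_, h, hh, rfl⟩
  classical
  obtain ⟨h, ⟨h0, hhb⟩, hk⟩ := Nat.find_spec hex
  refine ⟨h, h0, hhb, ?_⟩
  change r h + 1 = _
  by_contra hne'
  have hlt1 : r h + 1 < Module.finrank ℝ (Submodule.span ℝ V) :=
    lt_of_le_of_ne (hlt h hhb) hne'
  -- A tilting direction vanishing on `K` preserves both the zeros of `h` and its negative value at
  -- `b`; corank at least two leaves a vertex outside `K`.
  set K := Submodule.span ℝ {v ∈ V | h v = 0} ⊔ Submodule.span ℝ {b} with hK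
  have hKr : Module.finrank ℝ K ≤ r h + 1 := by
    refine (Submodule.finrank_add_le_finrank_add_finrank _ _).trans ?_
    exact Nat.add_le_add_left ((finrank_span_le_card _).trans (by simp)) _
  obtain ⟨w, hwV, hwK⟩ : ∃ w ∈ V, w ∉ K := by
    by_contra! hall
    have := Submodule.finrank_mono (Submodule.span_le.2 hall)
    omega
  obtain ⟨g, hgw, hgK⟩ := Submodule.exists_le_ker_of_notMem hwK
  have hgZ : ∀ v ∈ V, h v = 0 → g v = 0 := fun v hv hv0 =>
    hgK (Submodule.mem_sup_left (Submodule.subset_span ⟨hv, hv0⟩))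
  have hgb : g b = 0 := hgK (Submodule.mem_sup_right (Submodule.mem_span_singleton_self b))
  obtain ⟨g', hgw', hgZ', hgb'⟩ : ∃ g' : E →ₗ[ℝ] ℝ, g' w < 0 ∧ (∀ v ∈ V, h v = 0 → g' v = 0) ∧
      g' b = 0 := by
    rcases lt_or_gt_of_ne hgw with h1 | h1
    · exact ⟨g, h1, hgZ, hgb⟩
    · exact ⟨-g, by simpa using h1, fun v hv hv0 => by simp [hgZ v hv hv0], by simp [hgb]⟩
  obtain ⟨t, ht, m, hm, hgm, hhm⟩ := exists_tilt hV h0 hwV hgw'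
  have hb' : (h + t • g') b < 0 := by simpa [hgb'] using hhb
  have hr : r h < r (h + t • g') := by
    refine Submodule.finrank_lt_finrank_of_lt (lt_of_le_of_ne (Submodule.span_mono ?_) ?_)
    · exact fun v hv => ⟨hv.1, by simp [hv.2, hgZ' v hv.1 hv.2]⟩
    · intro heq
      have h1 : m ∈ Submodule.span ℝ {v ∈ V | h v = 0} := by
        rw [heq]
        exact Submodule.subset_span ⟨hm, hhm⟩
      have h2 : Submodule.span ℝ {v ∈ V | h v = 0} ≤ LinearMap.ker g' :=
        Submodule.span_le.2 fun v hv => hgZ' v hv.1 hv.2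
      exact hgm (h2 h1)
  refine Nat.find_min hex (m := Module.finrank ℝ (Submodule.span ℝ V) - r (h + t • g')) ?_
    ⟨_, ⟨ht, hb'⟩, rfl⟩
  have := hlt _ hb'
  omega

end Convex

/-! ### Integral determinants and lattices generated at height one -/

section Lattice

variable {E : Type*} [NormedAddCommGroup E] [InnerProductSpace ℝ E]

theorem exists_int_det_of_mem_span_int {D ι : Type*} [AddCommGroup D] [Module ℝ D] [Fintype ι]
    [DecidableEq ι] (b : Module.Basis ι ℝ D) (f : D →ₗ[ℝ] D)
    (hf : ∀ i, f (b i) ∈ Submodule.span ℤ (Set.range b)) :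
    ∃ m : ℤ, LinearMap.det f = m := by
  have h := fun j i => (b.mem_span_iff_repr_mem ℤ _).1 (hf j) i
  choose M hM using h
  refine ⟨(Matrix.of fun i j => M j i).det, ?_⟩
  rw [← LinearMap.det_toMatrix b, Int.cast_det]
  congr 1
  ext i j
  simpa [LinearMap.toMatrix_apply] using (hM j i).symm

/-- The functional `s` reads off the sum `m` of the integer coefficients. At height one this gives
`m = 1`, which passes from the lattice generated by `σ` to the one generated by differences with
`a`. -/
theorem sub_smul_mem_closure_of_mem_closure {σ : Set E} {s : E →ₗ[ℝ] ℝ} (hs : ∀ v ∈ σ, s v = 1)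
    {a : E} {Λ : AddSubgroup E} (hΛ : ∀ v ∈ σ, v - a ∈ Λ) {v : E}
    (hv : v ∈ AddSubgroup.closure σ) : ∃ m : ℤ, s v = m ∧ v - m • a ∈ Λ := by
  induction hv using AddSubgroup.closure_induction with
  | mem x hx => exact ⟨1, by simp [hs x hx], by simpa using hΛ x hx⟩
  | zero => exact ⟨0, by simp, by simp⟩
  | add x y _ _ hx hy =>
    obtain ⟨m, h1, h2⟩ := hx
    obtain ⟨k, h3, h4⟩ := hy
    refine ⟨m + k, by simp [h1, h3], ?_⟩
    have := Λ.add_mem h2 h4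
    rwa [sub_add_sub_comm, ← add_smul] at this
  | neg x _ hx =>
    obtain ⟨m, h1, h2⟩ := hx
    refine ⟨-m, by simp [h1], ?_⟩
    have := Λ.neg_mem h2
    have h3 : -x - (-m) • a = -(x - m • a) := by
      rw [neg_smul]
      abel
    rwa [h3]

theorem exists_linearMap_of_linearIndependent {σ : Set E}
    (hσ : LinearIndependent ℝ (fun x : σ => (x : E))) (e : σ → E) :
    ∃ A : E →ₗ[ℝ] E, ∀ x : σ, A x = e x := by
  obtain ⟨A, hA⟩ := LinearMap.exists_extend ((Module.Basis.span hσ).constr ℝ e)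
  refine ⟨A, fun x => ?_⟩
  have := congrArg (fun f => f (Module.Basis.span hσ x)) hA
  simp only [LinearMap.comp_apply, Module.Basis.constr_basis, Submodule.subtype_apply] at this
  rwa [Module.Basis.span_apply] at this

theorem span_le_of_subset_closure {V σ : Set E} (h : V ⊆ AddSubgroup.closure σ) :
    Submodule.span ℝ V ≤ Submodule.span ℝ σ := by
  refine Submodule.span_le.2 fun v hv => ?_
  have : AddSubgroup.closure σ ≤ (Submodule.span ℝ σ).toAddSubgroup :=
    (AddSubgroup.closure_le _).2 Submodule.subset_span
  exact this (h hv)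

end Lattice

/-! ### Volumes of simplices in the dimension of the polytope -/

section Volume

variable {E : Type*} [NormedAddCommGroup E] [InnerProductSpace ℝ E] [FiniteDimensional ℝ E]
  [MeasurableSpace E] [BorelSpace E]

/-- Scaling of the volume, in the dimension of an invariant subspace, by a linear map. -/
theorem euclideanHausdorffMeasure_image_linearMap {D : Submodule ℝ E} (A : E →ₗ[ℝ] E)
    (hA : ∀ x ∈ D, A x ∈ D) {S : Set E} {x₀ : E} (hS : ∀ x ∈ S, x - x₀ ∈ D) :
    μHE[Module.finrank ℝ D] (A '' S) =
      ENNReal.ofReal |LinearMap.det (A.restrict hA)| * μHE[Module.finrank ℝ D] S := by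
  have hiso : ∀ a : E, Isometry (fun y : D => a + (y : E)) := fun a =>
    (IsometryEquiv.addLeft a).isometry.comp isometry_subtype_coe
  set S' : Set D := {y | x₀ + (y : E) ∈ S} with hS'
  have h1 : S = (fun y : D => x₀ + (y : E)) '' S' := by
    ext x
    constructor
    · intro hx
      exact ⟨⟨x - x₀, hS x hx⟩, by simpa [hS'] using hx, by simp⟩
    · rintro ⟨y, hy, rfl⟩
      exact hy
  have h2 : A '' S = (fun y : D => A x₀ + (y : E)) '' (A.restrict hA '' S') := by
    rw [h1, Set.image_image, Set.image_image]
    refine Set.image_congr fun y _ => ?_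
    simp
  rw [h2, (hiso _).euclideanHausdorffMeasure_image, Measure.addHaar_image_linearMap,
    ← (hiso x₀).euclideanHausdorffMeasure_image S', ← h1]

/-- After an isometric translation into its direction space the hull is compact with nonempty
interior. Positivity and finiteness are what allow volumes to be cancelled. -/
theorem euclideanHausdorffMeasure_convexHull_pos_lt_top {τ : Set E} (hfin : τ.Finite)
    (hne : τ.Nonempty) :
    0 < μHE[affDim τ] (convexHull ℝ τ) ∧ μHE[affDim τ] (convexHull ℝ τ) < ⊤ := by
  obtain ⟨x₀, hx₀⟩ := hne
  let D := vectorSpan ℝ τ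
  let f : D →ᵃ[ℝ] E := D.subtype.toAffineMap + AffineMap.const ℝ D x₀
  have hf : ∀ y : D, f y = y + x₀ := fun y => rfl
  have hiso : Isometry f := (IsometryEquiv.addRight x₀).isometry.comp isometry_subtype_coe
  set τ' : Set D := f ⁻¹' τ with hτ'
  have h1 : f '' τ' = τ := by
    refine Set.image_preimage_eq_of_subset fun x hx => ?_
    exact ⟨⟨x - x₀, vsub_mem_vectorSpan ℝ hx hx₀⟩, by simp [hf]⟩
  have hne' : τ'.Nonempty := ⟨0, by simpa [hτ', hf] using hx₀⟩
  have hfin' : τ'.Finite := hfin.preimage hiso.injective.injOn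
  have hspan : affineSpan ℝ τ' = ⊤ := by
    rw [AffineSubspace.affineSpan_eq_top_iff_vectorSpan_eq_top_of_nonempty ℝ D D hne']
    apply Submodule.map_injective_of_injective D.subtype_injective
    have h2 := f.map_vectorSpan (s := τ')
    rw [h1] at h2
    have h3 : f.linear = D.subtype := by simp [f]
    rw [h3] at h2
    rw [h2, Submodule.map_top, Submodule.range_subtype]
  rw [← h1, ← f.image_convexHull, hiso.euclideanHausdorffMeasure_image, h1]
  change 0 < μHE[Module.finrank ℝ D] _ ∧ μHE[Module.finrank ℝ D] _ < ⊤
  constructor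
  · exact Measure.measure_pos_of_nonempty_interior _ (interior_convexHull_nonempty_iff_affineSpan_eq_top.2 hspan)
  · exact (hfin'.isCompact_convexHull (𝕜 := ℝ)).measure_lt_top

/-- A simplex whose vertices generate the lattice has minimal volume. -/
theorem simplexVolume_le_of_subset_closure {V σ τ : Set E} (hV : V.Finite) (hne : V.Nonempty)
    {s : E →ₗ[ℝ] ℝ} (hs : ∀ v ∈ V, s v = 1) (hσV : σ ⊆ V) (hτV : τ ⊆ V)
    (hσ : LinearIndependent ℝ (fun x : σ => (x : E)))
    (hτ : LinearIndependent ℝ (fun x : τ => (x : E))) (hτne : τ.Nonempty)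
    (hτd : affDim τ = affDim V) (hcl : V ⊆ AddSubgroup.closure σ) :
    simplexVolume (convexHull ℝ V) σ ≤ simplexVolume (convexHull ℝ V) τ := by
  classical
  have hsσ : ∀ v ∈ σ, s v = 1 := fun v hv => hs v (hσV hv)
  have hsτ : ∀ v ∈ τ, s v = 1 := fun v hv => hs v (hτV hv)
  have hspan : Submodule.span ℝ σ = Submodule.span ℝ V :=
    le_antisymm (Submodule.span_mono hσV) (span_le_of_subset_closure hcl)
  have hσne : σ.Nonempty := by
    rw [Set.nonempty_iff_ne_empty]
    rintro rfl
    have h1 := finrank_span_eq_affDim_add_one hne hs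
    rw [← hspan, Submodule.span_empty, finrank_bot] at h1
    omega
  have hσd : affDim σ = affDim V := by
    have h1 := finrank_span_eq_affDim_add_one hne hs
    have h2 := finrank_span_eq_affDim_add_one hσne hsσ
    rw [hspan] at h2
    omega
  have : Fintype σ := (hV.subset hσV).fintype
  have : Fintype τ := (hV.subset hτV).fintype
  have hcard : Fintype.card σ = Fintype.card τ := by
    rw [← finrank_span_eq_card hσ, ← finrank_span_eq_card hτ, Subtype.range_coe, Subtype.range_coe,
      finrank_span_eq_affDim_add_one hσne hsσ, finrank_span_eq_affDim_add_one hτne hsτ, hσd, hτd]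
  let e : σ ≃ τ := Fintype.equivOfCardEq hcard
  obtain ⟨A, hA⟩ := exists_linearMap_of_linearIndependent hσ (fun x => (e x : E))
  have hAimg : A '' σ = τ := by
    ext y
    constructor
    · rintro ⟨x, hx, rfl⟩
      rw [hA ⟨x, hx⟩]
      exact (e ⟨x, hx⟩).2
    · intro hy
      refine ⟨e.symm ⟨y, hy⟩, Subtype.coe_prop _, ?_⟩
      rw [hA]
      simp
  have hD : vectorSpan ℝ σ = vectorSpan ℝ V :=
    Submodule.eq_of_le_of_finrank_eq (vectorSpan_mono ℝ hσV) hσd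
  have hAD : ∀ x ∈ vectorSpan ℝ V, A x ∈ vectorSpan ℝ V := by
    rw [← hD]
    change vectorSpan ℝ σ ≤ (vectorSpan ℝ σ).comap A
    refine Submodule.span_le.2 ?_
    rintro _ ⟨a, ha, b, hb, rfl⟩
    change A (a - b) ∈ vectorSpan ℝ σ
    rw [hD, map_sub, hA ⟨a, ha⟩, hA ⟨b, hb⟩]
    exact vsub_mem_vectorSpan ℝ (hτV (e _).2) (hτV (e _).2)
  obtain ⟨a, ha⟩ := hσne
  have hσaff : AffineIndependent ℝ (fun x : σ => (x : E)) :=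
    (affineIndependent_iff_linearIndependent_of_map_eq_one fun x : σ => hsσ x x.2).2 hσ
  let f : {x : σ // x ≠ ⟨a, ha⟩} → vectorSpan ℝ V := fun x =>
    ⟨(x.1 : E) - a, vsub_mem_vectorSpan ℝ (hσV x.1.2) (hσV ha)⟩
  have hfli : LinearIndependent ℝ f := by
    have h1 := (affineIndependent_iff_linearIndependent_vsub ℝ _ (⟨a, ha⟩ : σ)).1 hσaff
    exact LinearIndependent.of_comp (vectorSpan ℝ V).subtype h1
  have hfsp : ⊤ ≤ Submodule.span ℝ (Set.range f) := by
    have h1 := vectorSpan_range_eq_span_range_vsub_right_ne ℝ (fun x : σ => (x : E)) ⟨a, ha⟩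
    rw [Subtype.range_coe, hD] at h1
    intro x _
    have h2 : (x : E) ∈ Submodule.map (vectorSpan ℝ V).subtype (Submodule.span ℝ (Set.range f)) := by
      rw [Submodule.map_span, ← Set.range_comp]
      exact h1.le x.2
    obtain ⟨y, hy, hyx⟩ := h2
    rwa [← Subtype.ext hyx]
  let b := Module.Basis.mk hfli hfsp
  have hbf : ∀ i, b i = f i := fun i => Module.Basis.mk_apply hfli hfsp i
  -- The edge vectors of `σ` at `a` form a lattice basis: they generate all differences of points of
  -- `V` with `a`.
  have hlat : ∀ v ∈ V, ∀ hv : v - a ∈ vectorSpan ℝ V,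
      (⟨v - a, hv⟩ : vectorSpan ℝ V) ∈ Submodule.span ℤ (Set.range b) := by
    intro v hvV hv
    let Λ : AddSubgroup E := ((Submodule.span ℤ (Set.range b)).toAddSubgroup).map
      (vectorSpan ℝ V).subtype.toAddMonoidHom
    have hΛ : ∀ u ∈ σ, u - a ∈ Λ := by
      intro u hu
      by_cases hua : u = a
      · subst hua
        simp
      · refine ⟨f ⟨⟨u, hu⟩, by simpa using hua⟩, ?_, rfl⟩
        exact Submodule.subset_span ⟨_, hbf _⟩
    obtain ⟨m, h1, h2⟩ := sub_smul_mem_closure_of_mem_closure hsσ hΛ (hcl hvV)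
    obtain rfl : m = 1 := by
      rw [hs v hvV] at h1
      exact_mod_cast h1.symm
    rw [one_smul] at h2
    obtain ⟨y, hy, hyx⟩ := h2
    have : (⟨v - a, hv⟩ : vectorSpan ℝ V) = y := Subtype.ext hyx.symm
    rw [this]
    exact hy
  obtain ⟨m, hm⟩ := exists_int_det_of_mem_span_int b (A.restrict hAD) (by
    intro i
    have ha' := hτV (e ⟨a, ha⟩).2
    have hi' := hτV (e i.1).2
    have h1 : A.restrict hAD (b i) =
        ⟨(e i.1 : E) - a, vsub_mem_vectorSpan ℝ hi' (hσV ha)⟩ -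
        ⟨(e ⟨a, ha⟩ : E) - a, vsub_mem_vectorSpan ℝ ha' (hσV ha)⟩ := by
      apply Subtype.ext
      rw [hbf]
      simp [f, LinearMap.restrict_apply, ← hA]
    rw [h1]
    exact Submodule.sub_mem _ (hlat _ hi' _) (hlat _ ha' _))
  have hvol : simplexVolume (convexHull ℝ V) τ =
      ENNReal.ofReal |(m : ℝ)| * simplexVolume (convexHull ℝ V) σ := by
    rw [simplexVolume, simplexVolume, affDim_convexHull, ← hAimg, ← A.image_convexHull, ← hm]
    refine euclideanHausdorffMeasure_image_linearMap A hAD (x₀ := a) fun x hx => ?_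
    rw [← hD, ← vectorSpan_convexHull_eq]
    exact vsub_mem_vectorSpan ℝ hx (subset_convexHull ℝ _ ha)
  have hpos := (euclideanHausdorffMeasure_convexHull_pos_lt_top (hV.subset hτV) hτne).1
  rw [hτd, ← affDim_convexHull] at hpos
  change 0 < simplexVolume (convexHull ℝ V) τ at hpos
  -- The simplex on `τ` has positive volume, so the integer `m` is nonzero and `|m| ≥ 1`.
  have hm0 : m ≠ 0 := by
    rintro rfl
    simp [hvol] at hpos
  rw [hvol]
  refine le_mul_of_one_le_left zero_le ?_
  rw [ENNReal.one_le_ofReal]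
  exact_mod_cast Int.one_le_abs hm0

/-- Replacing the apex of a pyramid scales its volume by the ratio of the heights. -/
theorem simplexVolume_insert {V σ : Set E} (hσV : σ ⊆ V) {p q : E}
    (hp : p ∈ V) (hq : q ∈ V) {h : E →ₗ[ℝ] ℝ} (hσ : ∀ v ∈ σ, h v = 0) (hhp : h p ≠ 0) :
    simplexVolume (convexHull ℝ V) (insert q σ) =
      ENNReal.ofReal |h q / h p| * simplexVolume (convexHull ℝ V) (insert p σ) := by
  -- This map fixes the hyperplane `h = 0`, sends `p` to `q`, and has determinant `1 + (h q - h p) /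
  -- h p = h q / h p`.
  let A := LinearMap.transvection ((h p)⁻¹ • h) (q - p)
  have hAx : ∀ x, A x = x + ((h p)⁻¹ * h x) • (q - p) := fun x => by
    simp [A, LinearMap.transvection.apply]
  have hu : q - p ∈ vectorSpan ℝ V := vsub_mem_vectorSpan ℝ hq hp
  have hAD : ∀ x ∈ vectorSpan ℝ V, A x ∈ vectorSpan ℝ V := fun x hx => by
    rw [hAx]
    exact Submodule.add_mem _ hx (Submodule.smul_mem _ _ hu)
  have himg : A '' insert p σ = insert q σ := by
    rw [Set.image_insert_eq]
    congr 1
    · rw [hAx, inv_mul_cancel₀ hhp, one_smul]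
      abel
    · refine (Set.image_congr fun x hx => ?_).trans (Set.image_id σ)
      simp [hAx, hσ x hx]
  have hdet : LinearMap.det (A.restrict hAD) = h q / h p := by
    have : A.restrict hAD = LinearMap.transvection
        (((h p)⁻¹ • h).comp (vectorSpan ℝ V).subtype) ⟨q - p, hu⟩ := by
      ext x
      simp [hAx, LinearMap.transvection.apply, LinearMap.restrict_apply]
    rw [this, LinearMap.transvection.det]
    simp only [LinearMap.comp_apply, Submodule.subtype_apply, LinearMap.smul_apply, smul_eq_mul,
      map_sub]
    field_simp
    ring
  rw [simplexVolume, simplexVolume, affDim_convexHull, ← himg, ← A.image_convexHull, ← hdet]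
  refine euclideanHausdorffMeasure_image_linearMap A hAD (x₀ := p) fun x hx => ?_
  rw [← vectorSpan_convexHull_eq]
  exact vsub_mem_vectorSpan ℝ (convexHull_mono (Set.insert_subset hp hσV) hx)
    (subset_convexHull ℝ _ hp)

end Volume

/-! ### Pulling triangulations, and facet width in compressed polytopes -/

section Pulling

variable {E : Type*} [NormedAddCommGroup E] [InnerProductSpace ℝ E]

theorem notMem_span_of_map_ne_zero {S : Set E} {h : E →ₗ[ℝ] ℝ} (hS : ∀ v ∈ S, h v = 0) {p : E}
    (hp : h p ≠ 0) : p ∉ Submodule.span ℝ S := fun hmem =>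
  hp ((Submodule.span_le.2 hS : Submodule.span ℝ S ≤ LinearMap.ker h) hmem)

open Classical in
theorem mem_filter_iff_of_functional {G Z : Set E} {l : List E} (hl : ∀ x, x ∈ l ↔ x ∈ Z)
    {h : E →ₗ[ℝ] ℝ} (hG : ∀ v ∈ Z, v ∈ G ↔ h v = 0) (x : E) :
    x ∈ l.filter (fun x => x ∈ G) ↔ x ∈ {v ∈ Z | h v = 0} := by
  rw [List.mem_filter, decide_eq_true_eq, hl]
  exact ⟨fun H => ⟨H.1, (hG x H.1).1 H.2⟩, fun H => ⟨H.1, (hG x H.1).2 H.2⟩⟩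

variable [FiniteDimensional ℝ E]

/-- On the hyperplane `s = 1` the constant `f x₀` is the linear functional `f x₀ • s`, so `f x₀ • s
- f` turns the maximizers of `f` into zeros of a nonnegative linear functional. -/
theorem IsFacetOf.exists_functional {G Z : Set E} (hG : IsFacetOf G (convexHull ℝ Z))
    {s : E →ₗ[ℝ] ℝ} (hs : ∀ v ∈ Z, s v = 1) :
    ∃ h : E →ₗ[ℝ] ℝ, (∀ v ∈ Z, 0 ≤ h v) ∧ G = convexHull ℝ {v ∈ Z | h v = 0} ∧
      (∀ v ∈ Z, v ∈ G ↔ h v = 0) ∧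
      Module.finrank ℝ (Submodule.span ℝ {v ∈ Z | h v = 0}) + 1 =
        Module.finrank ℝ (Submodule.span ℝ Z) := by
  obtain ⟨hne, hexp, hdim⟩ := hG
  obtain ⟨f, hf⟩ := hexp hne
  obtain ⟨x₀, hx₀⟩ := hne
  rw [hf] at hx₀
  let h : E →ₗ[ℝ] ℝ := f x₀ • s - f.toLinearMap
  have hh : ∀ x ∈ convexHull ℝ Z, h x = f x₀ - f x := fun x hx => by
    simp [h, map_eq_one_of_mem_convexHull hs hx]
  have h0 : ∀ v ∈ Z, 0 ≤ h v := fun v hv => by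
    have hv' := subset_convexHull ℝ Z hv
    rw [hh v hv', sub_nonneg]
    exact hx₀.2 v hv'
  have hGz : G = {x ∈ convexHull ℝ Z | h x = 0} := by
    rw [hf]
    ext x
    constructor
    · rintro ⟨hx, hmax⟩
      refine ⟨hx, ?_⟩
      rw [hh x hx]
      linarith [hmax x₀ hx₀.1, hx₀.2 x hx]
    · rintro ⟨hx, hx0⟩
      rw [hh x hx] at hx0
      exact ⟨hx, fun y hy => by linarith [hx₀.2 y hy]⟩
  have hGc := hGz.trans (sep_convexHull_eq_zero h0)
  refine ⟨h, h0, hGc, fun v hv => ?_, ?_⟩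
  · rw [hGz]
    exact ⟨fun h => h.2, fun h => ⟨subset_convexHull ℝ Z hv, h⟩⟩
  · have hZ'ne : {v ∈ Z | h v = 0}.Nonempty := by
      rw [← convexHull_nonempty_iff (𝕜 := ℝ), ← hGc, hf]
      exact ⟨x₀, hx₀⟩
    rw [hGc, affDim_convexHull, affDim_convexHull] at hdim
    rw [finrank_span_eq_affDim_add_one hZ'ne fun v hv => hs v hv.1,
      finrank_span_eq_affDim_add_one (hZ'ne.mono fun v hv => hv.1) hs, hdim]

theorem isFacetOf_of_functional {Z : Set E} {s : E →ₗ[ℝ] ℝ} (hs : ∀ v ∈ Z, s v = 1)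
    {h : E →ₗ[ℝ] ℝ} (h0 : ∀ v ∈ Z, 0 ≤ h v) (hne : {v ∈ Z | h v = 0}.Nonempty)
    (hr : Module.finrank ℝ (Submodule.span ℝ {v ∈ Z | h v = 0}) + 1 =
        Module.finrank ℝ (Submodule.span ℝ Z)) :
    IsFacetOf (convexHull ℝ {v ∈ Z | h v = 0}) (convexHull ℝ Z) := by
  refine ⟨hne.convexHull, fun _ => ⟨LinearMap.toContinuousLinearMap (-h), ?_⟩, ?_⟩
  · rw [← sep_convexHull_eq_zero h0]
    have hpos : ∀ x ∈ convexHull ℝ Z, 0 ≤ h x := fun x hx => by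
      have : convexHull ℝ Z ⊆ {x | 0 ≤ h x} :=
        convexHull_min h0 (convex_halfSpace_ge h.isLinear 0)
      exact this hx
    obtain ⟨z, hz, hz0⟩ := hne
    ext x
    constructor
    · rintro ⟨hx, hx0⟩
      exact ⟨hx, fun y hy => by simpa [hx0] using hpos y hy⟩
    · rintro ⟨hx, hmax⟩
      refine ⟨hx, le_antisymm ?_ (hpos x hx)⟩
      simpa [hz0] using hmax z (subset_convexHull ℝ Z hz)
  · rw [finrank_span_eq_affDim_add_one hne fun v hv => hs v hv.1,
      finrank_span_eq_affDim_add_one (hne.mono fun v hv => hv.1) hs] at hr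
    rw [affDim_convexHull, affDim_convexHull]
    omega

theorem span_insert_eq_of_finrank {S Z : Set E} {h : E →ₗ[ℝ] ℝ} (hS : ∀ v ∈ S, h v = 0) {p : E}
    (hp : h p ≠ 0) (hle : insert p S ⊆ Z)
    (hr : Module.finrank ℝ (Submodule.span ℝ S) + 1 = Module.finrank ℝ (Submodule.span ℝ Z)) :
    Submodule.span ℝ (insert p S) = Submodule.span ℝ Z := by
  refine Submodule.eq_of_le_of_finrank_le (Submodule.span_mono hle) ?_
  rw [← hr]
  refine Submodule.finrank_lt_finrank_of_lt
    (lt_of_le_of_ne (Submodule.span_mono (Set.subset_insert _ _)) fun heq => ?_)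
  apply notMem_span_of_map_ne_zero hS hp
  rw [heq]
  exact Submodule.subset_span (Set.mem_insert _ _)

/-- The simplices of a pulling triangulation are full-dimensional. -/
theorem IsPullingSimplex.linearIndependent_and_span {s : E →ₗ[ℝ] ℝ} {F : Set E} {l : List E}
    {σ : Set E} (H : IsPullingSimplex F l σ) : ∀ Z : Set E, F = convexHull ℝ Z →
    (∀ v ∈ Z, s v = 1) → (∀ x, x ∈ l ↔ x ∈ Z) →
    σ ⊆ Z ∧ LinearIndependent ℝ (fun x : σ => (x : E)) ∧
      Submodule.span ℝ σ = Submodule.span ℝ Z := by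
  induction H with
  | base P l hl =>
    intro Z _ hs hlZ
    obtain rfl : {x | x ∈ l} = Z := Set.ext hlZ
    refine ⟨subset_rfl, ?_, rfl⟩
    exact (affineIndependent_iff_linearIndependent_of_map_eq_one
      fun x : {x // x ∈ l} => hs x x.2).1 hl
  | pull P p l F σ hl hF hp hσ ih =>
    rintro Z rfl hs hlZ
    obtain ⟨h, h0, hFc, hFiff, hr⟩ := hF.exists_functional hs
    obtain ⟨h1, h2, h3⟩ := ih {v ∈ Z | h v = 0} hFc (fun v hv => hs v hv.1)
      (mem_filter_iff_of_functional hlZ hFiff)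
    have hpZ : p ∈ Z := (hlZ p).1 List.mem_cons_self
    have hhp : h p ≠ 0 := fun h => hp ((hFiff p hpZ).2 h)
    have hsub : insert p σ ⊆ Z := Set.insert_subset hpZ fun v hv => (h1 hv).1
    have hσ0 : ∀ v ∈ σ, h v = 0 := fun v hv => (h1 hv).2
    refine ⟨hsub, ?_, span_insert_eq_of_finrank hσ0 hhp hsub (h3 ▸ hr)⟩
    exact LinearIndepOn.id_insert (show LinearIndepOn ℝ id σ from h2)
      (notMem_span_of_map_ne_zero hσ0 hhp)

theorem eq_of_finrank_span_le_one {Z : Set E} {s : E →ₗ[ℝ] ℝ} (hs : ∀ v ∈ Z, s v = 1)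
    (hr : Module.finrank ℝ (Submodule.span ℝ Z) ≤ 1) {p q : E} (hp : p ∈ Z) (hq : q ∈ Z) :
    p = q := by
  have h1 := finrank_span_eq_affDim_add_one ⟨p, hp⟩ hs
  have h2 : vectorSpan ℝ Z = ⊥ := by
    rw [← Submodule.finrank_eq_zero (R := ℝ)]
    simp only [affDim] at h1
    omega
  have h3 : p - q ∈ vectorSpan ℝ Z := vsub_mem_vectorSpan ℝ hp hq
  rw [h2, Submodule.mem_bot, sub_eq_zero] at h3
  exact h3

/-- Supplies the common base of the two pyramids compared in `IsCompressed.map_eq_map_of_facet`. The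
induction runs on list length, since restricting to a facet missing the first point drops that
point. -/
theorem exists_isPullingSimplex {s : E →ₗ[ℝ] ℝ} (n : ℕ) : ∀ (Z : Set E) (l : List E),
    l.length ≤ n → (∀ v ∈ Z, s v = 1) → (∀ x, x ∈ l ↔ x ∈ Z) →
    ∃ σ, IsPullingSimplex (convexHull ℝ Z) l σ := by
  classical
  induction n with
  | zero =>
    intro Z l hn _ _
    obtain rfl : l = [] := List.length_eq_zero_iff.1 (by omega)
    have : IsEmpty {x : E // x ∈ ([] : List E)} := ⟨fun x => by simpa using x.2⟩
    exact ⟨_, .base _ _ (affineIndependent_of_subsingleton ℝ _)⟩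
  | succ n ih =>
    intro Z l hn hs hlZ
    by_cases hl : AffineIndependent ℝ (fun x : {x // x ∈ l} => (x : E))
    · exact ⟨_, .base _ _ hl⟩
    cases l with
    | nil =>
      have : IsEmpty {x : E // x ∈ ([] : List E)} := ⟨fun x => by simpa using x.2⟩
      exact absurd (affineIndependent_of_subsingleton ℝ _) hl
    | cons p l =>
      have hp : p ∈ Z := (hlZ p).1 List.mem_cons_self
      have hfin : Z.Finite := (List.finite_toSet (p :: l)).subset fun x hx => (hlZ x).2 hx
      -- The point `-p` has height `-1`, hence lies outside the cone; a facet cutting it off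
      -- satisfies `h p > 0` and so misses `p`.
      obtain ⟨h, h0, hhp, hr⟩ := exists_facet_functional hfin ⟨p, hp⟩ hs (b := -p)
        (Submodule.neg_mem _ (Submodule.subset_span hp)) (by
          intro c hc k hk heq
          have := congrArg s heq
          rw [map_neg, map_smul, hs p hp, map_eq_one_of_mem_convexHull hs hk, smul_eq_mul] at this
          linarith)
      rw [map_neg, neg_lt_zero] at hhp
      have hne : {v ∈ Z | h v = 0}.Nonempty := by
        rw [Set.nonempty_iff_ne_empty]
        intro hemp
        rw [hemp, Submodule.span_empty, finrank_bot] at hr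
        have : Subsingleton {x // x ∈ p :: l} := ⟨fun x y => Subtype.ext
          (eq_of_finrank_span_le_one hs (by omega) ((hlZ x).1 x.2) ((hlZ y).1 y.2))⟩
        exact hl (affineIndependent_of_subsingleton ℝ _)
      have hFiff : ∀ v ∈ Z, v ∈ convexHull ℝ {v ∈ Z | h v = 0} ↔ h v = 0 := fun v hv => by
        rw [← sep_convexHull_eq_zero h0]
        exact ⟨fun h => h.2, fun h => ⟨subset_convexHull ℝ Z hv, h⟩⟩
      have hpF : p ∉ convexHull ℝ {v ∈ Z | h v = 0} := fun hmem => hhp.ne' ((hFiff p hp).1 hmem)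
      obtain ⟨σ, hσ⟩ := ih {v ∈ Z | h v = 0}
        ((p :: l).filter (fun x => x ∈ convexHull ℝ {v ∈ Z | h v = 0})) (by
          rw [List.filter_cons_of_neg (by simpa using hpF)]
          exact (List.length_filter_le _ _).trans (by simpa using hn))
        (fun v hv => hs v hv.1) (mem_filter_iff_of_functional hlZ hFiff)
      exact ⟨_, .pull _ p l _ σ hl (isFacetOf_of_functional hs h0 hne hr) hpF (by convert hσ)⟩

variable [MeasurableSpace E] [BorelSpace E]

/-- In a compressed polytope, every facet has width one. -/
theorem IsCompressed.map_eq_map_of_facet {V : Set E} (hV : V.Finite) {s : E →ₗ[ℝ] ℝ}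
    (hs : ∀ v ∈ V, s v = 1) {L : AddSubgroup E} (hL : latticePoints (convexHull ℝ V) L = V)
    (hcomp : IsCompressed (convexHull ℝ V) L) {h : E →ₗ[ℝ] ℝ} (h0 : ∀ v ∈ V, 0 ≤ h v)
    (hr : Module.finrank ℝ (Submodule.span ℝ {v ∈ V | h v = 0}) + 1 =
        Module.finrank ℝ (Submodule.span ℝ V))
    {p q : E} (hp : p ∈ V) (hq : q ∈ V) (hhp : 0 < h p) (hhq : 0 < h q) : h p = h q := by
  classical
  rcases Set.eq_empty_or_nonempty {v ∈ V | h v = 0} with hemp | hne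
  · rw [hemp, Submodule.span_empty, finrank_bot] at hr
    rw [eq_of_finrank_span_le_one hs (by omega) hp hq]
  by_cases hpq : p = q
  · rw [hpq]
  by_cases hVli : LinearIndependent ℝ (fun x : V => (x : E))
  -- A simplex is never pulled, so this case is separate: a facet of a simplex misses only one
  -- vertex, whereas here both `p` and `q` are missed.
  · exfalso
    have hsp := span_insert_eq_of_finrank (fun v hv => hv.2) hhp.ne'
      (Set.insert_subset hp fun v hv => hv.1) hr
    have hqs : q ∈ Submodule.span ℝ (insert p {v ∈ V | h v = 0}) := by
      rw [hsp]
      exact Submodule.subset_span hq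
    have h1 := hVli.notMem_span_image (s := {x : V | (x : E) ≠ q}) (x := ⟨q, hq⟩) (by simp)
    apply h1
    refine Submodule.span_mono ?_ hqs
    rintro v (rfl | hv)
    · exact ⟨⟨v, hp⟩, hpq, rfl⟩
    · refine ⟨⟨v, hv.1⟩, ?_, rfl⟩
      rintro rfl
      exact hhq.ne' hv.2
  let m := (hV.subset (Set.sdiff_subset (t := {p, q}))).toFinset.toList
  have hm : ∀ x, x ∈ m ↔ x ∈ V ∧ x ≠ p ∧ x ≠ q := fun x => by simp [m]
  have hmnd : m.Nodup := Finset.nodup_toList _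
  have hFiff : ∀ v ∈ V, v ∈ convexHull ℝ {v ∈ V | h v = 0} ↔ h v = 0 := fun v hv => by
    rw [← sep_convexHull_eq_zero h0]
    exact ⟨fun h => h.2, fun h => ⟨subset_convexHull ℝ V hv, h⟩⟩
  have hpF : p ∉ convexHull ℝ {v ∈ V | h v = 0} := fun hmem => hhp.ne' ((hFiff p hp).1 hmem)
  have hqF : q ∉ convexHull ℝ {v ∈ V | h v = 0} := fun hmem => hhq.ne' ((hFiff q hq).1 hmem)
  have hmem : ∀ x, x ∈ p :: q :: m ↔ x ∈ V := fun x => by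
    simp only [List.mem_cons, hm]
    constructor
    · rintro (rfl | rfl | h)
      exacts [hp, hq, h.1]
    · tauto
  have hmem' : ∀ x, x ∈ q :: p :: m ↔ x ∈ V := fun x => by
    rw [← hmem]
    simp only [List.mem_cons]
    tauto
  -- Both `p` and `q` are filtered out on the facet, so the orders `p :: q :: m` and `q :: p :: m`
  -- induce the same order there and share `σ`.
  obtain ⟨σ, hσ⟩ := exists_isPullingSimplex (s := s) _ {v ∈ V | h v = 0}
    (m.filter (fun x => x ∈ convexHull ℝ {v ∈ V | h v = 0})) le_rfl (fun v hv => hs v hv.1) (by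
      intro x
      rw [← mem_filter_iff_of_functional hmem hFiff, List.filter_cons_of_neg (by simpa using hpF),
        List.filter_cons_of_neg (by simpa using hqF)])
  have hnot : ∀ l : List E, (∀ x, x ∈ l ↔ x ∈ V) →
      ¬ AffineIndependent ℝ (fun x : {x // x ∈ l} => (x : E)) := by
    intro l hl hai
    obtain rfl : {x | x ∈ l} = V := Set.ext hl
    exact hVli ((affineIndependent_iff_linearIndependent_of_map_eq_one
      fun x : {x // x ∈ l} => hs x x.2).1 hai)
  have hfacet := isFacetOf_of_functional hs h0 hne hr
  have hPp : IsPullingSimplex (convexHull ℝ V) (p :: q :: m) (insert p σ) := by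
    refine .pull _ p _ _ σ (hnot _ hmem) hfacet hpF ?_
    rw [List.filter_cons_of_neg (by simpa using hpF), List.filter_cons_of_neg (by simpa using hqF)]
    convert hσ
  have hPq : IsPullingSimplex (convexHull ℝ V) (q :: p :: m) (insert q σ) := by
    refine .pull _ q _ _ σ (hnot _ hmem') hfacet hqF ?_
    rw [List.filter_cons_of_neg (by simpa using hqF), List.filter_cons_of_neg (by simpa using hpF)]
    convert hσ
  have hminp := hcomp _ (by simp [hm, hmnd, hpq]) (fun x => by rw [hL, hmem]) _ hPp
  have hminq := hcomp _ (by simp [hm, hmnd, Ne.symm hpq]) (fun x => by rw [hL, hmem']) _ hPq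
  have hdim : ∀ {l τ}, τ.Nonempty → (∀ x, x ∈ l ↔ x ∈ V) →
      IsPullingSimplex (convexHull ℝ V) l τ → τ ⊆ V ∧
      AffineIndependent ℝ (fun x : τ => (x : E)) ∧ affDim τ = affDim V := by
    intro l τ hτ hl H
    obtain ⟨h1, h2, h3⟩ := H.linearIndependent_and_span V rfl hs hl
    refine ⟨h1, (affineIndependent_iff_linearIndependent_of_map_eq_one
      fun x : τ => hs x (h1 x.2)).2 h2, ?_⟩
    have h4 := finrank_span_eq_affDim_add_one hτ fun v hv => hs v (h1 hv)
    have h5 := finrank_span_eq_affDim_add_one (hτ.mono h1) hs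
    rw [h3] at h4
    omega
  obtain ⟨hp1, hp2, hp3⟩ := hdim (Set.insert_nonempty _ _) hmem hPp
  obtain ⟨hq1, hq2, hq3⟩ := hdim (Set.insert_nonempty _ _) hmem' hPq
  have heq : simplexVolume (convexHull ℝ V) (insert q σ) =
      simplexVolume (convexHull ℝ V) (insert p σ) :=
    le_antisymm
      (hminq _ (Set.insert_nonempty _ _) (by rwa [hL]) hp2 (by rw [hp3, affDim_convexHull]))
      (hminp _ (Set.insert_nonempty _ _) (by rwa [hL]) hq2 (by rw [hq3, affDim_convexHull]))
  have hσ0 : ∀ v ∈ σ, h v = 0 := by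
    have hσ1 := (hσ.linearIndependent_and_span (s := s) {v ∈ V | h v = 0} rfl
      (fun v hv => hs v hv.1) (by
        intro x
        rw [← mem_filter_iff_of_functional hmem hFiff, List.filter_cons_of_neg (by simpa using hpF),
          List.filter_cons_of_neg (by simpa using hqF)])).1
    exact fun v hv => (hσ1 hv).2
  have hratio := simplexVolume_insert (fun v hv => hp1 (Set.mem_insert_of_mem _ hv)) hp hq hσ0
    hhp.ne'
  obtain ⟨hpos, htop⟩ := euclideanHausdorffMeasure_convexHull_pos_lt_top (hV.subset hp1)
    (Set.insert_nonempty _ _)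
  rw [hp3, ← affDim_convexHull] at hpos htop
  change 0 < simplexVolume (convexHull ℝ V) (insert p σ) at hpos
  change simplexVolume (convexHull ℝ V) (insert p σ) < ⊤ at htop
  rw [heq, abs_of_pos (div_pos hhq hhp)] at hratio
  have h1 : ENNReal.ofReal (h q / h p) = 1 := by
    rw [← ENNReal.mul_left_inj hpos.ne' htop.ne, ← hratio, one_mul]
  rw [ENNReal.ofReal_eq_one, div_eq_one_iff_eq hhp.ne'] at h1
  exact h1.symm

end Pulling

/-! ### Integral maxima versus compressedness for a family of vectors -/

section Optimization

variable {E : Type*} [NormedAddCommGroup E] [InnerProductSpace ℝ E] {κ : Type*} [Fintype κ]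

/-- Whenever an integral point of the cone over the family `v` has a real representation with `i`-th
coefficient `y i`, it has an integral one whose `i`-th coefficient is at least as large. -/
def HasIntegralMaximum (v : κ → E) (i : κ) : Prop :=
  ∀ x : κ → ℤ, 0 ≤ x → ∀ y : κ → ℝ, 0 ≤ y → ∑ c, y c • v c = ∑ c, x c • v c →
    ∃ z : κ → ℤ, 0 ≤ z ∧ ∑ c, z c • v c = ∑ c, x c • v c ∧ y i ≤ z i

/-- A face of a face is a face. -/
theorem exists_functional_of_face_of_face {V : Set E} (hV : V.Finite) {f h : E →ₗ[ℝ] ℝ}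
    (hf : ∀ v ∈ V, 0 ≤ f v) (hh : ∀ v ∈ {v ∈ V | f v = 0}, 0 ≤ h v) :
    ∃ g : E →ₗ[ℝ] ℝ, (∀ v ∈ V, 0 ≤ g v) ∧
      {v ∈ {v ∈ V | f v = 0} | h v = 0} = {v ∈ V | g v = 0} := by
  obtain ⟨N, hN⟩ := (hV.image fun v => -h v / f v).bddAbove
  -- Taking `N + 1` instead of the bound `N` makes the inequality strict, so no new zeros appear off
  -- the face `f = 0`.
  have key : ∀ v ∈ V, 0 < f v → 0 < (N + 1) * f v + h v := by
    intro v hv hfv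
    have h1 : -h v / f v ≤ N := hN ⟨v, hv, rfl⟩
    rw [div_le_iff₀ hfv] at h1
    linarith
  refine ⟨(N + 1) • f + h, fun v hv => ?_, ?_⟩
  · rcases (hf v hv).eq_or_lt with h1 | h1
    · simpa [← h1] using hh v ⟨hv, h1.symm⟩
    · exact (key v hv h1).le
  · ext v
    constructor
    · rintro ⟨⟨h1, h2⟩, h3⟩
      exact ⟨h1, by simp [h2, h3]⟩
    · rintro ⟨h1, h2⟩
      simp only [LinearMap.add_apply, LinearMap.smul_apply, smul_eq_mul] at h2
      rcases (hf v h1).eq_or_lt with h3 | h3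
      · exact ⟨⟨h1, h3.symm⟩, by simpa [← h3] using h2⟩
      · exact absurd h2 (key v h1 h3).ne'

theorem exists_sum_eq_of_mem_convexHull {v : κ → E} {k : E}
    (hk : k ∈ convexHull ℝ (Set.range v)) : ∃ y : κ → ℝ, 0 ≤ y ∧ k = ∑ c, y c • v c := by
  classical
  have : convexHull ℝ (Set.range v) ⊆ {k | ∃ y : κ → ℝ, 0 ≤ y ∧ k = ∑ c, y c • v c} := by
    refine convexHull_min ?_ ?_
    · rintro _ ⟨c, rfl⟩
      refine ⟨Pi.single c 1, Pi.single_nonneg.2 zero_le_one, ?_⟩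
      simp [Pi.single_apply]
    · rintro _ ⟨y, hy, rfl⟩ _ ⟨z, hz, rfl⟩ a b ha hb _
      refine ⟨a • y + b • z, add_nonneg (smul_nonneg ha hy) (smul_nonneg hb hz), ?_⟩
      simp [add_smul, mul_smul, Finset.sum_add_distrib, Finset.smul_sum]
  exact this hk

/-- If `p` lies outside of a facet of the face spanned by `Z`, then every element of `Z` is an
integral combination of `p` and the vertices of the facet. -/
theorem mem_closure_insert_of_hasIntegralMaximum {v : κ → E} (H : ∀ i, HasIntegralMaximum v i)
    {f h : E →ₗ[ℝ] ℝ} (hf : ∀ c, 0 ≤ f (v c)) (hh : ∀ c, f (v c) = 0 → 0 ≤ h (v c)) {i j : κ}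
    (hi : f (v i) = 0) (hhi : h (v i) ≠ 0) (hj : f (v j) = 0)
    (hspan : v j ∈ Submodule.span ℝ
      (insert (v i) {x ∈ {x ∈ Set.range v | f x = 0} | h x = 0})) :
    v j ∈ AddSubgroup.closure (insert (v i) {x ∈ {x ∈ Set.range v | f x = 0} | h x = 0}) := by
  classical
  let K : Finset κ := {c | f (v c) = 0 ∧ h (v c) = 0}
  have hK : ∀ c, c ∈ K ↔ f (v c) = 0 ∧ h (v c) = 0 := fun c => by simp [K]
  have hKimg : {x ∈ {x ∈ Set.range v | f x = 0} | h x = 0} = v '' K := by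
    ext x
    constructor
    · rintro ⟨⟨⟨c, rfl⟩, h1⟩, h2⟩
      exact ⟨c, (hK c).2 ⟨h1, h2⟩, rfl⟩
    · rintro ⟨c, hc, rfl⟩
      exact ⟨⟨⟨c, rfl⟩, ((hK c).1 hc).1⟩, ((hK c).1 hc).2⟩
  rw [hKimg] at hspan ⊢
  obtain ⟨α, w, hw, hvj⟩ := Submodule.mem_span_insert.1 hspan
  obtain ⟨u, rfl⟩ := (Submodule.mem_span_image_finset_iff_exists_fun' ℝ).1 hw
  have hiK : i ∉ K := fun h => hhi ((hK i).1 h).2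
  have hhi' : 0 < h (v i) := lt_of_le_of_ne (hh i hi) hhi.symm
  have hhu : h (∑ c ∈ K, u c • v c) = 0 := by
    rw [map_sum]
    exact Finset.sum_eq_zero fun c hc => by simp [((hK c).1 hc).2]
  have hhj : h (v j) = α * h (v i) := by rw [hvj, map_add, hhu]; simp
  have hα : 0 ≤ α := nonneg_of_mul_nonneg_left (hhj ▸ hh j hj) hhi'
  -- Adding `N` times every facet vertex makes the real coefficients `u` nonnegative while keeping
  -- the point integral: `x` and `y` below represent the same point.
  obtain ⟨N, hN⟩ : ∃ N : ℕ, ∀ c, -u c ≤ N := by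
    obtain ⟨M, hM⟩ := (Set.finite_range fun c => -u c).bddAbove
    obtain ⟨N, hN⟩ := exists_nat_ge M
    exact ⟨N, fun c => (hM ⟨c, rfl⟩).trans hN⟩
  let x : κ → ℤ := Pi.single j 1 + fun c => if c ∈ K then (N : ℤ) else 0
  let y : κ → ℝ := Pi.single i α + fun c => if c ∈ K then (N : ℝ) + u c else 0
  have hxsum : ∑ c, x c • v c = v j + ∑ c ∈ K, (N : ℤ) • v c := by
    simp [x, add_smul, Finset.sum_add_distrib, Pi.single_apply, ite_smul]
  have hysum : ∑ c, y c • v c = α • v i + ∑ c ∈ K, ((N : ℝ) + u c) • v c := by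
    simp only [y, Pi.add_apply, add_smul, Finset.sum_add_distrib, Pi.single_apply, ite_smul,
      zero_smul, Finset.sum_ite_eq', Finset.mem_univ, if_true, Finset.sum_ite_mem,
      Finset.univ_inter]
  obtain ⟨z, hz, hzsum, hyz⟩ := H i x (by
      refine add_nonneg (Pi.single_nonneg.2 zero_le_one) fun c => ?_
      dsimp only
      split_ifs <;> simp) y (by
      refine add_nonneg (Pi.single_nonneg.2 hα) fun c => ?_
      dsimp only
      split_ifs
      · have := hN c
        simp only [Pi.zero_apply]
        linarith
      · simp) (by
      rw [hxsum, hysum, hvj]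
      simp only [add_smul, Finset.sum_add_distrib, Nat.cast_smul_eq_nsmul]
      abel)
  have hyi : y i = α := by simp [y, hiK]
  rw [hyi] at hyz
  rw [hxsum] at hzsum
  have hz0 : ∀ c, (0 : ℝ) ≤ z c := fun c => by exact_mod_cast hz c
  -- The point lies on the face `f = 0`, so every nonnegative representation of it is supported
  -- there.
  have hfz : ∀ c, (z c : ℝ) * f (v c) = 0 := by
    have h1 : ∑ c, (z c : ℝ) * f (v c) = 0 := by
      have h2 := congrArg f hzsum
      rw [map_sum, map_add, map_sum, hj, zero_add,
        Finset.sum_eq_zero (s := K) fun c hc => by simp [((hK c).1 hc).1]] at h2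
      simpa using h2
    intro c
    exact (Finset.sum_eq_zero_iff_of_nonneg fun c _ => mul_nonneg (hz0 c) (hf c)).1 h1 c
      (Finset.mem_univ c)
  have hhz0 : ∀ c, 0 ≤ (z c : ℝ) * h (v c) := by
    intro c
    rcases mul_eq_zero.1 (hfz c) with h1 | h1
    · simp [h1]
    · exact mul_nonneg (hz0 c) (hh c h1)
  -- The total value of `h` is `α * h (v i)`, and the term at `i` already contributes at least this
  -- much; the other terms are nonnegative, hence zero.
  have hhz : ∀ c ∈ Finset.univ.erase i, (z c : ℝ) * h (v c) = 0 := by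
    have h1 : ∑ c, (z c : ℝ) * h (v c) = α * h (v i) := by
      have h2 := congrArg h hzsum
      rw [map_sum, map_add, map_sum, hhj,
        Finset.sum_eq_zero (s := K) fun c hc => by simp [((hK c).1 hc).2], add_zero] at h2
      simpa using h2
    rw [← Finset.add_sum_erase _ _ (Finset.mem_univ i)] at h1
    have h3 := mul_le_mul_of_nonneg_right hyz hhi'.le
    exact (Finset.sum_eq_zero_iff_of_nonneg fun c _ => hhz0 c).1
      (le_antisymm (by linarith) (Finset.sum_nonneg fun c _ => hhz0 c))
  set Λ := AddSubgroup.closure (insert (v i) (v '' K)) with hΛ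
  have hKΛ : ∀ c ∈ K, v c ∈ Λ := fun c hc =>
    AddSubgroup.subset_closure (Set.mem_insert_of_mem _ ⟨c, hc, rfl⟩)
  rw [← Finset.add_sum_erase _ _ (Finset.mem_univ i), ← sub_eq_iff_eq_add] at hzsum
  rw [← hzsum]
  refine Λ.sub_mem (Λ.add_mem (Λ.zsmul_mem (AddSubgroup.subset_closure (Set.mem_insert _ _)) _)
    (Λ.sum_mem fun c hc => ?_)) (Λ.sum_mem fun c hc => Λ.zsmul_mem (hKΛ c hc) _)
  by_cases hzc : (z c : ℝ) = 0
  · have : z c = 0 := by exact_mod_cast hzc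
    simp [this]
  · exact Λ.zsmul_mem (hKΛ c ((hK c).2 ⟨(mul_eq_zero.1 (hfz c)).resolve_left hzc,
      (mul_eq_zero.1 (hhz c hc)).resolve_left hzc⟩)) _

variable [FiniteDimensional ℝ E]

/-- Under integrality of the maxima, the simplices of a pulling triangulation are unimodular. -/
theorem IsPullingSimplex.subset_closure {v : κ → E} {s : E →ₗ[ℝ] ℝ} (hs : ∀ c, s (v c) = 1)
    (H : ∀ i, HasIntegralMaximum v i) {F : Set E} {l : List E} {σ : Set E}
    (hσ : IsPullingSimplex F l σ) : ∀ f : E →ₗ[ℝ] ℝ, (∀ x ∈ Set.range v, 0 ≤ f x) →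
    F = convexHull ℝ {x ∈ Set.range v | f x = 0} →
    (∀ x, x ∈ l ↔ x ∈ {x ∈ Set.range v | f x = 0}) →
    {x ∈ Set.range v | f x = 0} ⊆ AddSubgroup.closure σ := by
  induction hσ with
  | base P l hl =>
    intro f _ _ hl x hx
    exact AddSubgroup.subset_closure ((hl x).2 hx)
  | pull P p l F σ hl hF hp hσ ih =>
    rintro f hf rfl hl
    have hsZ : ∀ x ∈ {x ∈ Set.range v | f x = 0}, s x = 1 := by
      rintro _ ⟨⟨c, rfl⟩, _⟩
      exact hs c
    obtain ⟨h, h0, hFc, hFiff, hr⟩ := hF.exists_functional hsZ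
    obtain ⟨g, hg, hgZ⟩ := exists_functional_of_face_of_face (Set.finite_range v) hf h0
    have hfil := mem_filter_iff_of_functional hl hFiff
    have hpZ := (hl p).1 List.mem_cons_self
    have hhp : h p ≠ 0 := fun h => hp ((hFiff p hpZ).2 h)
    have hcl := ih g hg (by rw [← hgZ, hFc]) (by rw [← hgZ]; exact hfil)
    rw [← hgZ] at hcl
    obtain ⟨⟨i, rfl⟩, hi⟩ := hpZ
    have hsp := span_insert_eq_of_finrank (fun v hv => hv.2) hhp
      (Set.insert_subset (show v i ∈ {x ∈ Set.range v | f x = 0} from ⟨⟨i, rfl⟩, hi⟩)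
        fun v hv => hv.1) hr
    rintro _ ⟨⟨j, rfl⟩, hj⟩
    have hmem := mem_closure_insert_of_hasIntegralMaximum H (fun c => hf _ ⟨c, rfl⟩)
      (fun c hc => h0 _ ⟨⟨c, rfl⟩, hc⟩) hi hhp hj (by
        rw [hsp]
        exact Submodule.subset_span ⟨⟨j, rfl⟩, hj⟩)
    refine (AddSubgroup.closure_le _).2 ?_ hmem
    refine Set.insert_subset (AddSubgroup.subset_closure (Set.mem_insert _ _)) fun x hx => ?_
    exact AddSubgroup.closure_mono (Set.subset_insert _ _) (hcl hx)

variable [MeasurableSpace E] [BorelSpace E]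

theorem isCompressed_of_hasIntegralMaximum {v : κ → E} {s : E →ₗ[ℝ] ℝ} (hs : ∀ c, s (v c) = 1)
    {L : AddSubgroup E} (hL : latticePoints (convexHull ℝ (Set.range v)) L = Set.range v)
    (H : ∀ i, HasIntegralMaximum v i) : IsCompressed (convexHull ℝ (Set.range v)) L := by
  intro l _ hl σ hσ τ hτne hτ hτai hτd
  rw [hL] at hl hτ
  have hsV : ∀ x ∈ Set.range v, s x = 1 := by
    rintro _ ⟨c, rfl⟩
    exact hs c
  have hZ : {x ∈ Set.range v | (0 : E →ₗ[ℝ] ℝ) x = 0} = Set.range v := by simp [Set.range]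
  -- The zero functional exhibits the whole polytope as a face, which starts the induction.
  have hcl := hσ.subset_closure hs H 0 (by simp) (by rw [hZ]) (by rwa [hZ])
  rw [hZ] at hcl
  obtain ⟨h1, h2, -⟩ := hσ.linearIndependent_and_span _ rfl hsV hl
  refine simplexVolume_le_of_subset_closure (Set.finite_range v) (hτne.mono hτ) hsV h1 hτ h2
    ((affineIndependent_iff_linearIndependent_of_map_eq_one fun x : τ => hsV x (hτ x.2)).1 hτai)
    hτne (by rw [hτd, affDim_convexHull]) hcl

/-- In a compressed polytope, rounding up one coefficient of a lattice point of the cone does not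
leave the cone. -/
theorem IsCompressed.exists_sub_ceil_smul {v : κ → E} {s : E →ₗ[ℝ] ℝ} (hs : ∀ c, s (v c) = 1)
    (hL : latticePoints (convexHull ℝ (Set.range v)) (AddSubgroup.closure (Set.range v)) =
      Set.range v)
    (hcomp : IsCompressed (convexHull ℝ (Set.range v)) (AddSubgroup.closure (Set.range v)))
    {y : κ → ℝ} (hy : 0 ≤ y)
    (hb : ∑ c, y c • v c ∈ AddSubgroup.closure (Set.range v)) (i : κ) :
    ∃ y' : κ → ℝ, 0 ≤ y' ∧ ∑ c, y c • v c - ⌈y i⌉ • v i = ∑ c, y' c • v c := by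
  set b := ∑ c, y c • v c with hbdef
  have hsV : ∀ x ∈ Set.range v, s x = 1 := by
    rintro _ ⟨c, rfl⟩
    exact hs c
  by_contra! hcon
  obtain ⟨h, h0, hneg, hr⟩ := exists_facet_functional (Set.finite_range v) ⟨v i, i, rfl⟩ hsV
    (b := b - ⌈y i⌉ • v i) (by
      refine Submodule.sub_mem _ (Submodule.sum_mem _ fun c _ =>
        Submodule.smul_mem _ _ (Submodule.subset_span (Set.mem_range_self c))) ?_
      exact zsmul_mem (Submodule.subset_span (Set.mem_range_self i)) _) (by
      intro c hc k hk heq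
      obtain ⟨w, hw, rfl⟩ := exists_sum_eq_of_mem_convexHull hk
      refine hcon (c • w) (smul_nonneg hc hw) ?_
      rw [heq, Finset.smul_sum]
      simp [mul_smul])
  have h0' : ∀ c, 0 ≤ h (v c) := fun c => h0 _ ⟨c, rfl⟩
  have hhb : y i * h (v i) ≤ h b := by
    rw [hbdef, map_sum]
    simp only [map_smul, smul_eq_mul]
    exact Finset.single_le_sum (f := fun c => y c * h (v c))
      (fun c _ => mul_nonneg (hy c) (h0' c)) (Finset.mem_univ i)
  rw [map_sub, map_zsmul, zsmul_eq_mul, sub_neg] at hneg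
  rcases (h0' i).eq_or_lt with hi | hi
  · rw [← hi, mul_zero] at hhb hneg
    linarith
  -- By width one, `h` is either `0` or `h (v i)` on each generator. The integer `n` obtained for
  -- `b` satisfies `y i ≤ n < ⌈y i⌉`, which is impossible.
  have hint : ∀ x ∈ AddSubgroup.closure (Set.range v), ∃ n : ℤ, h x = n * h (v i) := by
    intro x hx
    induction hx using AddSubgroup.closure_induction with
    | mem x hx =>
      rcases (h0 x hx).eq_or_lt with h1 | h1
      · exact ⟨0, by simp [← h1]⟩
      · refine ⟨1, ?_⟩
        rw [hcomp.map_eq_map_of_facet (Set.finite_range v) hsV hL h0 hr hx ⟨i, rfl⟩ h1 hi]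
        simp
    | zero => exact ⟨0, by simp⟩
    | add x y _ _ hx hy =>
      obtain ⟨m, h1⟩ := hx
      obtain ⟨k, h2⟩ := hy
      exact ⟨m + k, by rw [map_add, h1, h2]; push_cast; ring⟩
    | neg x _ hx =>
      obtain ⟨m, h1⟩ := hx
      exact ⟨-m, by rw [map_neg, h1]; push_cast; ring⟩
  obtain ⟨n, hn⟩ := hint b hb
  rw [hn] at hhb hneg
  have h1 : y i ≤ n := le_of_mul_le_mul_right hhb hi
  have h2 : (n : ℝ) < ⌈y i⌉ := lt_of_mul_lt_mul_right hneg hi.le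
  have h3 : ⌈y i⌉ ≤ n := Int.ceil_le.2 h1
  have h4 : n < ⌈y i⌉ := by exact_mod_cast h2
  omega

/-- The cone over a compressed polytope is normal. -/
theorem IsCompressed.exists_int_sum_eq {v : κ → E} {s : E →ₗ[ℝ] ℝ} (hs : ∀ c, s (v c) = 1)
    (hL : latticePoints (convexHull ℝ (Set.range v)) (AddSubgroup.closure (Set.range v)) =
      Set.range v)
    (hcomp : IsCompressed (convexHull ℝ (Set.range v)) (AddSubgroup.closure (Set.range v)))
    (n : ℕ) : ∀ y : κ → ℝ, 0 ≤ y → ∑ c, y c ≤ n →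
      ∑ c, y c • v c ∈ AddSubgroup.closure (Set.range v) →
      ∃ z : κ → ℤ, 0 ≤ z ∧ ∑ c, z c • v c = ∑ c, y c • v c := by
  classical
  have hzero : ∀ y : κ → ℝ, (∀ c, y c = 0) →
      ∃ z : κ → ℤ, 0 ≤ z ∧ ∑ c, z c • v c = ∑ c, y c • v c := fun y hy =>
    ⟨0, le_rfl, by simp [hy]⟩
  induction n with
  | zero =>
    intro y hy hn _
    refine hzero y fun c => ?_
    have h1 : ∑ c, y c = 0 := le_antisymm (by simpa using hn) (Finset.sum_nonneg fun c _ => hy c)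
    exact (Finset.sum_eq_zero_iff_of_nonneg fun c _ => hy c).1 h1 c (Finset.mem_univ c)
  | succ n ih =>
    intro y hy hn hb
    by_cases hall : ∀ c, y c = 0
    · exact hzero y hall
    push Not at hall
    obtain ⟨i, hi⟩ := hall
    obtain ⟨y', hy', heq⟩ := hcomp.exists_sub_ceil_smul hs hL hy hb i
    -- The height `s`, which is the sum of the coefficients, drops by `⌈y i⌉ ≥ 1`, so the induction
    -- on its bound applies.
    have hceil : (1 : ℝ) ≤ ⌈y i⌉ := by
      exact_mod_cast Int.one_le_ceil_iff.2 (lt_of_le_of_ne (hy i) hi.symm)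
    obtain ⟨z, hz, hzs⟩ := ih y' hy' (by
      have h1 := congrArg s heq
      simp only [map_sub, map_sum, map_smul, map_zsmul, hs, smul_eq_mul, mul_one, zsmul_eq_mul]
        at h1
      push_cast at hn
      linarith) (by
      rw [← heq]
      exact sub_mem hb (zsmul_mem (AddSubgroup.subset_closure (Set.mem_range_self i)) _))
    refine ⟨z + Pi.single i ⌈y i⌉, add_nonneg hz (Pi.single_nonneg.2 (Int.ceil_nonneg (hy i))), ?_⟩
    simp [add_smul, Finset.sum_add_distrib, hzs, ← heq, Pi.single_apply, ite_smul]

/-- Split off `⌈y i⌉ • v i`; the remainder is a lattice point of the cone and has an integral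
representation by normality. -/
theorem IsCompressed.hasIntegralMaximum {v : κ → E} {s : E →ₗ[ℝ] ℝ} (hs : ∀ c, s (v c) = 1)
    (hL : latticePoints (convexHull ℝ (Set.range v)) (AddSubgroup.closure (Set.range v)) =
      Set.range v)
    (hcomp : IsCompressed (convexHull ℝ (Set.range v)) (AddSubgroup.closure (Set.range v)))
    (i : κ) : HasIntegralMaximum v i := by
  classical
  intro x _ y hy hxy
  have hb : ∑ c, y c • v c ∈ AddSubgroup.closure (Set.range v) := by
    rw [hxy]
    exact sum_mem fun c _ => zsmul_mem (AddSubgroup.subset_closure (Set.mem_range_self c)) _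
  obtain ⟨y', hy', heq⟩ := hcomp.exists_sub_ceil_smul hs hL hy hb i
  obtain ⟨n, hn⟩ := exists_nat_ge (∑ c, y' c)
  obtain ⟨z, hz, hzs⟩ := hcomp.exists_int_sum_eq hs hL n y' hy' hn (by
    rw [← heq]
    exact sub_mem hb (zsmul_mem (AddSubgroup.subset_closure (Set.mem_range_self i)) _))
  refine ⟨z + Pi.single i ⌈y i⌉, add_nonneg hz (Pi.single_nonneg.2 (Int.ceil_nonneg (hy i))),
    ?_, ?_⟩
  · rw [← hxy]
    simp [add_smul, Finset.sum_add_distrib, hzs, ← heq, Pi.single_apply, ite_smul]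
  · have h1 : (0 : ℝ) ≤ z i := by exact_mod_cast hz i
    simp only [Pi.add_apply, Pi.single_eq_same, Int.cast_add]
    linarith [Int.le_ceil (y i)]

end Optimization

/-! ### Columns of a matrix: lattice points, optimal values and symmetries -/

section ColumnFamily

variable {ρ κ : Type*}

/-- The columns of an integral matrix, as points of Euclidean space. -/
def column (A : Matrix ρ κ ℤ) (c : κ) : EuclideanSpace ℝ ρ :=
  WithLp.toLp 2 fun r => (A r c : ℝ)

theorem column_apply (A : Matrix ρ κ ℤ) (c : κ) (r : ρ) : column A c r = A r c := rfl

/-- The lattice points in the polytope of a `0/1` matrix are the columns. -/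
theorem latticePoints_columnPolytope [Fintype ρ] {A : Matrix ρ κ ℤ} (hA : ∀ r c, A r c = 0 ∨ A r c = 1) :
    latticePoints (columnPolytope A) (columnLattice A) = columnSet A := by
  classical
  apply Set.Subset.antisymm
  · rintro x ⟨hxP, hxL⟩
    have hint : ∀ r, ∃ m : ℤ, x r = m := by
      intro r
      clear hxP
      induction hxL using AddSubgroup.closure_induction with
      | mem x hx =>
        obtain ⟨c, rfl⟩ := hx
        exact ⟨A r c, rfl⟩
      | zero => exact ⟨0, by simp⟩
      | add x y _ _ hx hy =>
        obtain ⟨m, hm⟩ := hx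
        obtain ⟨k, hk⟩ := hy
        exact ⟨m + k, by simp [hm, hk]⟩
      | neg x _ hx =>
        obtain ⟨m, hm⟩ := hx
        exact ⟨-m, by simp [hm]⟩
    have hcol : ∀ r c, (A r c : ℝ) = 0 ∨ (A r c : ℝ) = 1 := fun r c => by
      rcases hA r c with h | h <;> simp [h]
    have hlow : ∀ r, 0 ≤ x r := by
      intro r
      have : columnPolytope A ⊆ {y | 0 ≤ EuclideanSpace.proj (𝕜 := ℝ) r y} := by
        refine convexHull_min ?_
          (convex_halfSpace_ge (EuclideanSpace.proj (𝕜 := ℝ) r).toLinearMap.isLinear 0)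
        rintro _ ⟨c, rfl⟩
        rcases hcol r c with h | h <;> simp [h]
      exact this hxP
    have hup : ∀ r, x r ≤ 1 := by
      intro r
      have : columnPolytope A ⊆ {y | EuclideanSpace.proj (𝕜 := ℝ) r y ≤ 1} := by
        refine convexHull_min ?_
          (convex_halfSpace_le (EuclideanSpace.proj (𝕜 := ℝ) r).toLinearMap.isLinear 1)
        rintro _ ⟨c, rfl⟩
        rcases hcol r c with h | h <;> simp [h]
      exact this hxP
    have hx01 : ∀ r, x r = 0 ∨ x r = 1 := by
      intro r
      obtain ⟨m, hm⟩ := hint r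
      have h1 : (0 : ℝ) ≤ m := hm ▸ hlow r
      have h2 : (m : ℝ) ≤ 1 := hm ▸ hup r
      rw [hm]
      have h3 : 0 ≤ m := by exact_mod_cast h1
      have h4 : m ≤ 1 := by exact_mod_cast h2
      obtain rfl | rfl : m = 0 ∨ m = 1 := by omega
      · simp
      · simp
    -- Up to a constant, `h` is the Hamming distance to `x` on `0/1` vectors, so `x` is its unique
    -- minimizer among them. Were `x` not a column, `h` would exceed `h x` on the whole polytope.
    let h : EuclideanSpace ℝ ρ →ₗ[ℝ] ℝ :=
      ∑ r, (1 - 2 * x r) • (EuclideanSpace.proj (𝕜 := ℝ) r).toLinearMap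
    have hh : ∀ y, h y = ∑ r, (1 - 2 * x r) * y r := fun y => by simp [h]
    have hterm : ∀ c r, (1 - 2 * x r) * x r ≤ (1 - 2 * x r) * column A c r := by
      intro c r
      rw [column_apply]
      rcases hx01 r with h1 | h1 <;> rcases hcol r c with h2 | h2 <;> rw [h1, h2] <;> norm_num
    by_contra hx
    have : columnPolytope A ⊆ {y | h x < h y} := by
      refine convexHull_min ?_ (convex_halfSpace_gt h.isLinear _)
      rintro _ ⟨c, rfl⟩
      change h x < h (column A c)
      rw [hh, hh]
      refine lt_of_le_of_ne (Finset.sum_le_sum fun r _ => hterm c r) fun heq => hx ⟨c, ?_⟩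
      rw [Finset.sum_eq_sum_iff_of_le fun r _ => hterm c r] at heq
      ext r
      have h3 := heq r (Finset.mem_univ r)
      refine (mul_left_cancel₀ ?_ h3).symm
      rcases hx01 r with h1 | h1 <;> rw [h1] <;> norm_num
    exact lt_irrefl (h x) (this hxP)
  · intro x hx
    exact ⟨subset_convexHull ℝ _ hx, AddSubgroup.subset_closure hx⟩

variable [Fintype κ]

theorem sum_smul_column_apply (A : Matrix ρ κ ℤ) (y : κ → ℝ) (r : ρ) :
    (∑ c, y c • column A c) r = ((A.map (Int.cast : ℤ → ℝ)).mulVec y) r := by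
  simp [Matrix.mulVec, dotProduct, column_apply, mul_comm]

theorem sum_zsmul_column_apply (A : Matrix ρ κ ℤ) (x : κ → ℤ) (r : ρ) :
    (∑ c, x c • column A c) r = ((A.mulVec x r : ℤ) : ℝ) := by
  simp [Matrix.mulVec, dotProduct, column_apply, mul_comm]

variable [Fintype ρ]

/-- If no integral point reaches `y i`, integrality bounds the integral supremum by `⌈y i⌉ - 1 < y
i`. Comparing with each feasible `y` makes attainment and finiteness of the real optimum irrelevant.
-/
theorem IPMax_eq_LPMax_iff_hasIntegralMaximum (A : Matrix ρ κ ℤ) (i : κ) :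
    (∀ b, IPFeasible A b → IPMax A b i = LPMax A b i) ↔ HasIntegralMaximum (column A) i := by
  constructor
  · intro H x hx y hy hxy
    have heq := H (A.mulVec x) ⟨x, hx, rfl⟩
    by_contra! hcon
    have hle : ((y i : ℝ) : EReal) ≤ LPMax A (A.mulVec x) i := by
      refine le_sSup ⟨y, hy, ?_, rfl⟩
      ext r
      rw [← sum_smul_column_apply, hxy, sum_zsmul_column_apply]
    have hlt : IPMax A (A.mulVec x) i ≤ (((⌈y i⌉ - 1 : ℤ) : ℝ) : EReal) := by
      refine sSup_le ?_
      rintro _ ⟨z, hz, hzA, rfl⟩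
      have hzi := hcon z hz (by
        ext r
        rw [sum_zsmul_column_apply, sum_zsmul_column_apply, hzA])
      have h1 : z i < ⌈y i⌉ := Int.lt_ceil.2 hzi
      have h2 : z i ≤ ⌈y i⌉ - 1 := by omega
      exact_mod_cast h2
    rw [← heq] at hle
    have h3 : y i ≤ ((⌈y i⌉ - 1 : ℤ) : ℝ) := by exact_mod_cast hle.trans hlt
    have h4 := Int.ceil_le.2 h3
    omega
  · rintro H b ⟨x, hx, rfl⟩
    apply le_antisymm
    · refine sSup_le_sSup ?_
      rintro _ ⟨z, hz, hzA, rfl⟩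
      refine ⟨fun c => z c, fun c => Int.cast_nonneg (hz c), ?_, rfl⟩
      ext r
      rw [← hzA]
      simp [Matrix.mulVec, dotProduct]
    · refine sSup_le ?_
      rintro _ ⟨y, hy, hyA, rfl⟩
      obtain ⟨z, hz, hzx, hyz⟩ := H x hx y hy (by
        ext r
        rw [sum_smul_column_apply, sum_zsmul_column_apply, hyA])
      refine le_trans (b := ((z i : ℝ) : EReal)) (by exact_mod_cast hyz) (le_sSup ⟨z, hz, ?_, rfl⟩)
      ext r
      have h1 := congrArg (fun w : EuclideanSpace ℝ ρ => w r) hzx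
      simp only [sum_zsmul_column_apply] at h1
      exact_mod_cast h1

/-- Integrality of the maxima is invariant under symmetries of the matrix. -/
theorem HasIntegralMaximum.of_symmetry {A : Matrix ρ κ ℤ} {i : κ}
    (H : HasIntegralMaximum (column A) i) (e : κ ≃ κ) {π : ρ → ρ} (hπ : Function.Surjective π)
    (hA : ∀ r c, A r (e c) = A (π r) c) : HasIntegralMaximum (column A) (e i) := by
  intro x hx y hy hxy
  have hmulR : ∀ (w : κ → ℝ) r, (∑ c, w c • column A c) r = (∑ c, w (e c) • column A c) (π r) := by
    intro w r
    rw [← Equiv.sum_comp e]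
    simp [column_apply, hA]
  have hmulZ : ∀ (w : κ → ℤ) r, (∑ c, w c • column A c) r = (∑ c, w (e c) • column A c) (π r) := by
    intro w r
    rw [← Equiv.sum_comp e]
    simp [column_apply, hA]
  obtain ⟨z, hz, hzx, hyz⟩ := H (x ∘ e) (fun c => hx (e c)) (y ∘ e) (fun c => hy (e c)) (by
    ext r
    obtain ⟨r, rfl⟩ := hπ r
    exact (hmulR y r).symm.trans ((congrArg (fun w : EuclideanSpace ℝ ρ => w r) hxy).trans
      (hmulZ x r)))
  refine ⟨z ∘ e.symm, fun c => hz (e.symm c), ?_, by simpa using hyz⟩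
  ext r
  rw [hmulZ (z ∘ e.symm) r, hmulZ x r]
  simpa using congrArg (fun w : EuclideanSpace ℝ ρ => w (π r)) hzx

end ColumnFamily

/-! ### Symmetries of the marginal matrix -/

section MarginSymmetry

variable {n : ℕ} (Δ : MarginComplex n) (d : Fin n → ℕ)

theorem MarginComplex.exists_facet : Nonempty Δ.Facet := by
  obtain ⟨S, -, hS⟩ := (Set.toFinite Δ.faces).exists_le_maximal Δ.empty_mem
  exact ⟨⟨S, hS⟩⟩

theorem marginalMatrix_eq_zero_or_one (r : MarginIndex Δ d) (c : Cell d) :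
    marginalMatrix Δ d r c = 0 ∨ marginalMatrix Δ d r c = 1 := by
  unfold marginalMatrix
  split_ifs <;> simp

/-- The total of a single margin is a linear functional with value one on all columns. -/
theorem exists_functional_eq_one : ∃ s : EuclideanSpace ℝ (MarginIndex Δ d) →ₗ[ℝ] ℝ,
    ∀ c, s (column (marginalMatrix Δ d) c) = 1 := by
  obtain ⟨S⟩ := Δ.exists_facet
  let row : (∀ i : {i // i ∈ S.1}, Fin (d i)) → MarginIndex Δ d := fun j => ⟨S, j⟩
  refine ⟨∑ j, (EuclideanSpace.proj (𝕜 := ℝ) (row j)).toLinearMap, fun c => ?_⟩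
  rw [LinearMap.sum_apply]
  change ∑ j, ((if (fun i : {i // i ∈ S.1} => c i) = j then 1 else 0 : ℤ) : ℝ) = 1
  simp

theorem marginalMatrix_add [∀ i, NeZero (d i)] (a : Cell d) (r : MarginIndex Δ d) (c : Cell d) :
    marginalMatrix Δ d r (c + a) = marginalMatrix Δ d ⟨r.1, fun i => r.2 i - a i⟩ c := by
  unfold marginalMatrix
  refine if_congr ?_ rfl rfl
  simp only [funext_iff, Pi.add_apply, eq_sub_iff_add_eq]

/-- Adding `a` modulo the table sizes permutes the cells, carries `0` to `a`, and only relabels the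
entries within each margin. -/
theorem hasIntegralMaximum_marginalMatrix [∀ i, NeZero (d i)]
    (H : HasIntegralMaximum (column (marginalMatrix Δ d)) 0) (a : Cell d) :
    HasIntegralMaximum (column (marginalMatrix Δ d)) a := by
  have := H.of_symmetry (Equiv.addRight a)
    (π := fun r : MarginIndex Δ d => ⟨r.1, fun i => r.2 i - a i⟩)
    (fun r => ⟨⟨r.1, fun i => r.2 i + a i⟩, Sigma.ext rfl (heq_of_eq (funext fun i => add_sub_cancel_right _ _))⟩)
    (fun r c => marginalMatrix_add Δ d a r c)
  simpa using this

end MarginSymmetry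

end

theorem mainTheorem9 {n : ℕ} (Δ : MarginComplex n) (d : Fin n → ℕ) [∀ i, NeZero (d i)] :
    (∀ b : MarginIndex Δ d → ℤ, IPFeasible (marginalMatrix Δ d) b →
      IPMax (marginalMatrix Δ d) b 0 = LPMax (marginalMatrix Δ d) b 0) ↔
    IsCompressed (columnPolytope (marginalMatrix Δ d)) (columnLattice (marginalMatrix Δ d)) := by
  obtain ⟨s, hs⟩ := exists_functional_eq_one Δ d
  have hL := latticePoints_columnPolytope (marginalMatrix_eq_zero_or_one Δ d)
  rw [IPMax_eq_LPMax_iff_hasIntegralMaximum]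
  exact ⟨fun H => isCompressed_of_hasIntegralMaximum hs hL (hasIntegralMaximum_marginalMatrix Δ d H),
    fun H => IsCompressed.hasIntegralMaximum hs hL H 0⟩
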